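/- Let $R$ be a commutative $\mathbb C$-algebra (the ring of parameters), $q\in R^\times$, $f\in\mathbb Z$, and let $S=R[\Theta,\Theta^{-1}][[Q^{1/2}]]$ with formal variables $\Theta$ and $Q^{1/2}$. Let $\mathcal F$ be the fermionic Fock space with basis $\underline A=\underline{a_1}\wedge\underline{a_2}\wedge\cdots$ ($a_1>a_2>\cdots$) indexed by the sets $A\subset\mathbb Z+\frac12$ for which the set of positive elements of $A$ and the set of negative half-integers not in $A$ are finite; the difference of the numbers of elements of these two sets is the charge of $\underline A$, and $|0\rangle=\underline{-1/2}\wedge\underline{-3/2}\wedge\cdots$. Let $\psi_r$ (resp. $\psi_r^*$) insert (resp. remove) $\underline r$ with the sign $(-1)^{\#\{a\in A:\,a>r\}}$, the result being $0$ if this is impossible. Let $\psi^i_r,\psi^{i*}_r$ act on the $i$-th factor of a tensor product of copies $\mathcal F_i$ of $\mathcal F$, with the Koszul sign convention (parity of the charge). Vectors are formal, possibly infinite, $S$-linear combinations of basis vectors. For an integer $n$ write $\mathbf n=n+\frac12$. A vector of $\mathcal F_1\otimes\cdots\otimes\mathcal F_N$ is a *Bogoliubov transform* if it has the form $$\exp\Big(\sum_{i,j=1}^N\sum_{m,n\ge0}A^{ij}_{mn}\,\psi^i_{\mathbf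 m}\psi^{j*}_{-\mathbf n}\Big)|0\rangle,\qquad A^{ij}_{mn}\in S$$ (coefficients in $R$, independent of $Q$ and $\Theta$, are included). The gluing vector is $$|P^f_{ab}\rangle=\exp\Big[\sum_{n\ge0}Q^{n+1/2}\big(\Theta\,\epsilon_n\psi^a_{\mathbf n}\psi^{b*}_{-\mathbf n}+\Theta^{-1}\epsilon'_n\psi^b_{\mathbf n}\psi^{a*}_{-\mathbf n}\big)\Big]|0\rangle\in\mathcal F_a\otimes\mathcal F_b,$$ $$\epsilon_n=i^{1+f}(-1)^{(1+f)n}q^{fn(n+1)/2},\qquad \epsilon'_n=i^{1+f}(-1)^{(1+f)n}q^{-fn(n+1)/2}.$$ For a Bogoliubov transform $V\in\mathcal F_1\otimes\cdots\otimes\mathcal F_M\otimes\mathcal F_a\otimes\mathcal F_b$ with coefficients $A^{ij}_{mn}$, the self-gluing is $\tilde G^f(V)=(V,P^f_{ab})\in\mathcal F_1\otimes\cdots\otimes\mathcal F_M$, where the bilinear inner product is taken over $\mathcal F_a\otimes\mathcal F_b$, the basis vectors being orthonormal, and the sum over them is computed separately in each power of $Q^{1/2}$; its closed part is $$\tilde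 G^f(V)_{closed}=\Big(\exp\Big(\sum_{i,j\in\{a,b\}}\sum_{m,n\ge0}A^{ij}_{mn}\psi^i_{\mathbf m}\psi^{j*}_{-\mathbf n}\Big)|0\rangle_{ab},\,P^f_{ab}\Big)\in S,$$ and the normalized self-gluing is $G^f(V)=\tilde G^f(V)/\tilde G^f(V)_{closed}$. For Bogoliubov transforms $V_1\in\mathcal F_1\otimes\cdots\otimes\mathcal F_M\otimes\mathcal F_a$ and $V_2\in\mathcal F_{M+1}\otimes\cdots\otimes\mathcal F_{M+N}\otimes\mathcal F_b$, view $V_1\otimes V_2$ as a vector of $\mathcal F_1\otimes\cdots\otimes\mathcal F_{M+N}\otimes\mathcal F_a\otimes\mathcal F_b$ (reordering the factors with Koszul signs); the normalized gluing is $G^f(V_1,V_2)=G^f(V_1\otimes V_2)$. **Theorem.** Let $M,N\ge0$. 1. For every Bogoliubov transform $V\in\mathcal F_1\otimes\cdots\otimes\mathcal F_M\otimes\mathcal F_a\otimes\mathcal F_b$, the inner products defining $\tilde G^f(V)$ and $\tilde G^f(V)_{closed}$ are well defined (only finitely many basis vectors contribute to each power of $Q^{1/2}$), $\tilde G^f(V)_{closed}$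 is invertible in $S$, and $G^f(V)$ is a Bogoliubov transform in $\mathcal F_1\otimes\cdots\otimes\mathcal F_M$. 2. For all Bogoliubov transforms $V_1\in\mathcal F_1\otimes\cdots\otimes\mathcal F_M\otimes\mathcal F_a$ and $V_2\in\mathcal F_{M+1}\otimes\cdots\otimes\mathcal F_{M+N}\otimes\mathcal F_b$, the vector $V_1\otimes V_2$ is a Bogoliubov transform whose coefficients are those of $V_1$ and $V_2$, with $A^{ij}_{mn}=0$ if $i,j$ do not belong to the same factor; the inner products defining $\tilde G^f(V_1\otimes V_2)$ and $\tilde G^f(V_1\otimes V_2)_{closed}$ are well defined in the same sense, $\tilde G^f(V_1\otimes V_2)_{closed}$ is invertible in $S$, and $G^f(V_1,V_2)$ is a Bogoliubov transform in $\mathcal F_1\otimes\cdots\otimes\mathcal F_{M+N}$. -/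

import Mathlib

noncomputable section

namespace FermionGluing

open scoped Classical Nat LaurentPolynomial PowerSeries

/-! ### Semi-infinite wedges

A half-integer `n + 1/2` is represented by the integer `n`.  Thus the negative half-integers are
`Set.Iio 0`, and `-(n + 1/2)` is represented by `-n - 1`. -/

/-- Admissible sets of half-integers; they index the standard basis of the Fock space. -/
@[ext]
structure Maya where
  carrier : Set ℤ
  holes_finite : (Set.Iio 0 \ carrier).Finite
  particles_finite : (carrier \ Set.Iio 0).Finite

namespace Maya

instance : Membership ℤ Maya := ⟨fun A r => r ∈ A.carrier⟩

/-- The set of all negative half-integers, i.e. the vacuum. -/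
def vacuum : Maya := ⟨Set.Iio 0, by simp, by simp⟩

/-- Add the half-integer `r + 1/2`. -/
def insert (A : Maya) (r : ℤ) : Maya where
  carrier := Insert.insert r A.carrier
  holes_finite := A.holes_finite.subset fun _ hx => ⟨hx.1, fun h => hx.2 (Or.inr h)⟩
  particles_finite := (A.particles_finite.union (Set.finite_singleton r)).subset (by
    rintro x ⟨hx | hx, h⟩
    · exact Or.inr hx
    · exact Or.inl ⟨hx, h⟩)

/-- Remove the half-integer `r + 1/2`. -/
def erase (A : Maya) (r : ℤ) : Maya where
  carrier := A.carrier \ {r}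
  holes_finite := (A.holes_finite.union (Set.finite_singleton r)).subset (by
    rintro x ⟨hx, h⟩
    by_cases hr : x = r
    · exact Or.inr hr
    · exact Or.inl ⟨hx, fun h' => h ⟨h', hr⟩⟩)
  particles_finite := A.particles_finite.subset fun _ hx => ⟨hx.1.1, hx.2⟩

/-- The charge `|A \ ℤ₋+1/2| - |ℤ₋+1/2 \ A|`. -/
def charge (A : Maya) : ℤ := ((A.carrier \ Set.Iio 0).ncard : ℤ) - ((Set.Iio 0 \ A.carrier).ncard : ℤ)

/-- The number of elements of `A` above `r + 1/2`, i.e. the number of factors that stand before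
the position of `r + 1/2` in the wedge `a₁ ∧ a₂ ∧ ⋯`. -/
def above (A : Maya) (r : ℤ) : ℕ := {a : ℤ | a ∈ A.carrier ∧ r < a}.ncard

end Maya

/-- Basis states of the `N`-component Fock space. -/
abbrev States (N : ℕ) : Type := Fin N → Maya

/-- The (completed) `N`-component fermionic Fock space `F₁ ⊗ ⋯ ⊗ F_N` over `S`: formal, possibly
infinite, linear combinations of basis states, given by their coefficients. -/
abbrev Fock (N : ℕ) (S : Type*) : Type _ := States N → S

section Operators

variable {N : ℕ} {S : Type*} [CommRing S]

/-- The vacuum `|0⟩ ⊗ ⋯ ⊗ |0⟩`. -/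
def vac : Fock N S := Pi.single (fun _ => Maya.vacuum) 1

/-- The sign with which `ψ^i_r` and `ψ^{i*}_r` act: the Koszul sign for passing the components
before the `i`-th one, times the sign of the position of `r + 1/2` in the `i`-th wedge. -/
def sgn (A : States N) (i : Fin N) (r : ℤ) : ℤˣ :=
  Int.negOnePow (∑ j ∈ Finset.Iio i, (A j).charge + (A i).above r)

/-- The state with `r + 1/2` added to the `i`-th component. -/
def add (A : States N) (i : Fin N) (r : ℤ) : States N := Function.update A i ((A i).insert r)

/-- The state with `r + 1/2` removed from the `i`-th component. -/
def remove (A : States N) (i : Fin N) (r : ℤ) : States N := Function.update A i ((A i).erase r)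

/-- The operator `ψ^i_{r+1/2}`; see `psi_single` for its effect on basis states. -/
def psi (i : Fin N) (r : ℤ) : Fock N S →ₗ[S] Fock N S where
  toFun V := fun A => if r ∈ A i then ((sgn A i r : ℤ) : S) * V (remove A i r) else 0
  map_add' V W := by ext A; by_cases h : r ∈ A i <;> simp [h, mul_add]
  map_smul' c V := by ext A; by_cases h : r ∈ A i <;> simp [h, mul_left_comm]

/-- The operator `ψ^{i*}_{r+1/2}`; see `psiStar_single` for its effect on basis states. -/
def psiStar (i : Fin N) (r : ℤ) : Fock N S →ₗ[S] Fock N S where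
  toFun V := fun A => if r ∈ A i then 0 else ((sgn A i r : ℤ) : S) * V (add A i r)
  map_add' V W := by ext A; by_cases h : r ∈ A i <;> simp [h, mul_add]
  map_smul' c V := by ext A; by_cases h : r ∈ A i <;> simp [h, mul_left_comm]

theorem mem_add_self (A : States N) (i : Fin N) (r : ℤ) : r ∈ add A i r i := by
  show r ∈ (add A i r i).carrier
  simp [add, Maya.insert]

theorem notMem_remove_self (A : States N) (i : Fin N) (r : ℤ) : r ∉ remove A i r i := by
  show r ∉ (remove A i r i).carrier
  simp [remove, Maya.erase]

theorem remove_add (A : States N) (i : Fin N) (r : ℤ) (h : r ∉ A i) :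
    remove (add A i r) i r = A := by
  unfold remove add
  rw [Function.update_idem, Function.update_eq_iff]
  refine ⟨Maya.ext ?_, fun _ _ => rfl⟩
  have h' : r ∉ (A i).carrier := h
  simp [Maya.erase, Maya.insert, h']

theorem add_remove (A : States N) (i : Fin N) (r : ℤ) (h : r ∈ A i) :
    add (remove A i r) i r = A := by
  unfold remove add
  rw [Function.update_idem, Function.update_eq_iff]
  refine ⟨Maya.ext ?_, fun _ _ => rfl⟩
  have h' : r ∈ (A i).carrier := h
  simp [Maya.erase, Maya.insert, h']

theorem sgn_add (A : States N) (i : Fin N) (r : ℤ) : sgn (add A i r) i r = sgn A i r := by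
  have h1 : ∑ j ∈ Finset.Iio i, (add A i r j).charge = ∑ j ∈ Finset.Iio i, (A j).charge := by
    refine Finset.sum_congr rfl fun j hj => ?_
    rw [add, Function.update_of_ne (Finset.mem_Iio.1 hj).ne]
  have h2 : (add A i r i).above r = (A i).above r := by
    unfold Maya.above
    congr 1
    ext a
    simp only [add, Function.update_self, Maya.insert, Set.mem_ofPred_eq, Set.mem_insert_iff]
    constructor
    · rintro ⟨rfl | h, h'⟩
      · exact absurd h' (lt_irrefl _)
      · exact ⟨h, h'⟩
    · exact fun h => ⟨Or.inr h.1, h.2⟩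
  rw [sgn, sgn, h1, h2]

theorem sgn_remove (A : States N) (i : Fin N) (r : ℤ) (h : r ∈ A i) :
    sgn (remove A i r) i r = sgn A i r := by
  rw [← sgn_add (remove A i r), add_remove A i r h]

/-- `ψ^i_r` inserts `r` into the `i`-th wedge, with sign, and kills the states that contain it. -/
theorem psi_single (i : Fin N) (r : ℤ) (B : States N) :
    psi i r (Pi.single B (1 : S)) =
      if r ∈ B i then 0 else ((sgn B i r : ℤ) : S) • Pi.single (add B i r) 1 := by
  ext A
  simp only [psi, LinearMap.coe_mk, AddHom.coe_mk]
  by_cases hB : r ∈ B i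
  · rw [if_pos hB, Pi.zero_apply]
    split_ifs with hA
    · have : remove A i r ≠ B := by
        rintro rfl; exact notMem_remove_self A i r hB
      simp [this]
    · rfl
  · rw [if_neg hB, Pi.smul_apply]
    by_cases hAB : A = add B i r
    · subst hAB
      rw [if_pos (mem_add_self B i r), remove_add B i r hB, sgn_add]
      simp
    · rw [Pi.single_eq_of_ne hAB, smul_zero]
      split_ifs with hA
      · have : remove A i r ≠ B := by
          rintro rfl; exact hAB (add_remove A i r hA).symm
        simp [this]
      · rfl

/-- `ψ^{i*}_r` removes `r` from the `i`-th wedge, with sign, and kills the states without it. -/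
theorem psiStar_single (i : Fin N) (r : ℤ) (B : States N) :
    psiStar i r (Pi.single B (1 : S)) =
      if r ∈ B i then ((sgn B i r : ℤ) : S) • Pi.single (remove B i r) 1 else 0 := by
  ext A
  simp only [psiStar, LinearMap.coe_mk, AddHom.coe_mk]
  by_cases hB : r ∈ B i
  · rw [if_pos hB, Pi.smul_apply]
    by_cases hAB : A = remove B i r
    · subst hAB
      rw [if_neg (notMem_remove_self B i r), add_remove B i r hB, sgn_remove B i r hB]
      simp
    · rw [Pi.single_eq_of_ne hAB, smul_zero]
      split_ifs with hA
      · rfl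
      · have : add A i r ≠ B := by
          rintro rfl; exact hAB (remove_add A i r hA).symm
        simp [this]
  · rw [if_neg hB, Pi.zero_apply]
    split_ifs with hA
    · rfl
    · have : add A i r ≠ B := by
        rintro rfl; exact hB (mem_add_self A i r)
      simp [this]

/-- Families of coefficients `A^{ij}_{mn}`, `m, n ≥ 0`. -/
abbrev Coeffs (N : ℕ) (S : Type*) : Type _ := Fin N → Fin N → ℕ → ℕ → S

/-- The term `A^{ij}_{mn} ψ^i_{m+1/2} ψ^{j*}_{-(n+1/2)} V`, for `p = (i, j, m, n)`. -/
def quadTerm (A : Coeffs N S) (V : Fock N S) (p : Fin N × Fin N × ℕ × ℕ) : Fock N S :=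
  A p.1 p.2.1 p.2.2.1 p.2.2.2 • psi p.1 (p.2.2.1 : ℤ) (psiStar p.2.1 (-(p.2.2.2 : ℤ) - 1) V)

/-- The quadratic expression `∑_{i,j} ∑_{m,n ≥ 0} A^{ij}_{mn} ψ^i_{m+1/2} ψ^{j*}_{-(n+1/2)}` in the
fermionic creators, as an operator on the completed Fock space.  By `quadTerm_finite` each
coefficient is a finite sum. -/
def quad (A : Coeffs N S) (V : Fock N S) : Fock N S :=
  fun T => ∑ᶠ p : Fin N × Fin N × ℕ × ℕ, quadTerm A V p T

theorem quadTerm_ne_zero {A : Coeffs N S} {V : Fock N S} {p : Fin N × Fin N × ℕ × ℕ}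
    {T : States N} (h : quadTerm A V p T ≠ 0) :
    (p.2.2.1 : ℤ) ∈ T p.1 ∧ (-(p.2.2.2 : ℤ) - 1) ∉ T p.2.1 ∧
      V (add (remove T p.1 p.2.2.1) p.2.1 (-(p.2.2.2 : ℤ) - 1)) ≠ 0 := by
  obtain ⟨i, j, m, n⟩ := p
  simp only [quadTerm, psi, psiStar, LinearMap.coe_mk, AddHom.coe_mk, Pi.smul_apply,
    smul_eq_mul] at h
  by_cases h1 : (m : ℤ) ∈ T i
  · rw [if_pos h1] at h
    by_cases h2 : (-(n : ℤ) - 1) ∈ remove T i m j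
    · simp [h2] at h
    · rw [if_neg h2] at h
      refine ⟨h1, fun h3 => h2 ?_, fun h3 => h (by simp [h3])⟩
      show (-(n : ℤ) - 1) ∈ (remove T i m j).carrier
      by_cases hij : j = i
      · subst hij
        simp only [remove, Function.update_self, Maya.erase]
        refine ⟨h3, ?_⟩
        simp only [Set.mem_singleton_iff]
        omega
      · rw [remove, Function.update_of_ne hij]
        exact h3
  · simp [h1] at h

theorem quadTerm_finite (A : Coeffs N S) (V : Fock N S) (T : States N) :
    (Function.support fun p => quadTerm A V p T).Finite := by
  have hm : ∀ i, {m : ℕ | (m : ℤ) ∈ T i}.Finite := fun i =>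
    Set.Finite.subset ((T i).particles_finite.preimage (f := fun m : ℕ => (m : ℤ))
      (fun _ _ _ _ h => by simpa using h)) fun m hm => ⟨hm, by simp⟩
  have hn : ∀ j, {n : ℕ | (-(n : ℤ) - 1) ∉ T j}.Finite := fun j =>
    Set.Finite.subset ((T j).holes_finite.preimage (f := fun n : ℕ => (-(n : ℤ) - 1))
      (fun _ _ _ _ h => by simpa using h)) fun n hn => ⟨by
        simp only [Set.mem_Iio]; omega, hn⟩
  refine ((Set.finite_univ (α := Fin N)).prod ((Set.finite_univ (α := Fin N)).prod
    ((Set.finite_iUnion hm).prod (Set.finite_iUnion hn)))).subset ?_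
  rintro ⟨i, j, m, n⟩ hp
  obtain ⟨h1, h2, -⟩ := quadTerm_ne_zero hp
  exact ⟨trivial, trivial, Set.mem_iUnion.2 ⟨i, h1⟩, Set.mem_iUnion.2 ⟨j, h2⟩⟩

/-- The number of positive half-integers in a state. -/
def particles (T : States N) : ℕ := ∑ i, ((T i).carrier \ Set.Iio 0).ncard

theorem particles_quad (T : States N) (i j : Fin N) (m n : ℕ) (h1 : (m : ℤ) ∈ T i) :
    particles T = particles (add (remove T i m) j (-(n : ℤ) - 1)) + 1 := by
  have hadd : ∀ U : States N, particles (add U j (-(n : ℤ) - 1)) = particles U := by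
    intro U
    refine Finset.sum_congr rfl fun l _ => ?_
    by_cases hl : l = j
    · subst hl
      simp only [add, Function.update_self, Maya.insert]
      rw [Set.insert_sdiff_of_mem _ (by simp only [Set.mem_Iio]; omega)]
    · rw [add, Function.update_of_ne hl]
  rw [hadd, particles, particles, ← Finset.add_sum_erase _ _ (Finset.mem_univ i),
    ← Finset.add_sum_erase _ _ (Finset.mem_univ i)]
  have hrest : ∑ l ∈ Finset.univ.erase i, ((remove T i m l).carrier \ Set.Iio 0).ncard
      = ∑ l ∈ Finset.univ.erase i, ((T l).carrier \ Set.Iio 0).ncard := by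
    refine Finset.sum_congr rfl fun l hl => ?_
    rw [remove, Function.update_of_ne (Finset.ne_of_mem_erase hl)]
  have hi : ((remove T i m i).carrier \ Set.Iio 0).ncard + 1 = ((T i).carrier \ Set.Iio 0).ncard := by
    have hs : (remove T i m i).carrier \ Set.Iio 0 = ((T i).carrier \ Set.Iio 0) \ {(m : ℤ)} := by
      simp only [remove, Function.update_self, Maya.erase]
      rw [Set.sdiff_sdiff_comm]
    have hmem : (m : ℤ) ∈ (T i).carrier \ Set.Iio 0 := ⟨h1, by simp⟩
    rw [hs, Set.ncard_sdiff_singleton_add_one hmem (T i).particles_finite]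
  rw [hrest, ← hi]
  omega

theorem quad_iterate_vac_ne_zero (A : Coeffs N S) (k : ℕ) :
    ∀ T : States N, (quad A)^[k] vac T ≠ 0 → particles T = k := by
  induction k with
  | zero =>
    intro T hT
    have : T = fun _ => Maya.vacuum := by
      by_contra hne
      exact hT (Pi.single_eq_of_ne hne _)
    subst this
    simp [particles, Maya.vacuum]
  | succ k ih =>
    intro T hT
    rw [Function.iterate_succ_apply'] at hT
    obtain ⟨p, hp⟩ : ∃ p, quadTerm A ((quad A)^[k] vac) p T ≠ 0 := by
      by_contra! h
      exact hT (by simp [quad, h])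
    obtain ⟨h1, -, h3⟩ := quadTerm_ne_zero hp
    rw [particles_quad T p.1 p.2.1 p.2.2.1 p.2.2.2 h1, ih _ h3]

variable [Algebra ℂ S]

/-- The vector `exp(∑_{i,j} ∑_{m,n ≥ 0} A^{ij}_{mn} ψ^i_{m+1/2} ψ^{j*}_{-(n+1/2)}) |0⟩`.
By `quad_iterate_vac_finite` each coefficient is a finite sum. -/
def bogoliubov (A : Coeffs N S) : Fock N S :=
  fun T => ∑ᶠ k : ℕ, ((k ! : ℂ)⁻¹) • ((quad A)^[k] vac T)

theorem quad_iterate_vac_finite (A : Coeffs N S) (T : States N) :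
    (Function.support fun k : ℕ => ((k ! : ℂ)⁻¹) • ((quad A)^[k] vac T)).Finite := by
  refine (Set.finite_singleton (particles T)).subset fun k hk => ?_
  refine (quad_iterate_vac_ne_zero A k T fun h => hk ?_).symm
  show ((k ! : ℂ)⁻¹) • ((quad A)^[k] vac T) = 0
  rw [h, smul_zero]

/-- `V` is a Bogoliubov transform of the vacuum. -/
def IsBogoliubov (V : Fock N S) : Prop := ∃ A : Coeffs N S, V = bogoliubov A

end Operators

/-! ### The gluing vectors -/

section Gluing

variable {R : Type*} [CommRing R] [Algebra ℂ R]

/-- The ring `R[Θ, Θ⁻¹]⟦Q^{1/2}⟧`; the power series variable is `Q^{1/2}`. -/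
abbrev GlueRing (R : Type*) [CommRing R] : Type _ := R[T;T⁻¹]⟦X⟧

/-- `ε_n = i^{1+f} (-1)^{(1+f)n} q^{f n(n+1)/2}`. -/
def eps (q : Rˣ) (f : ℤ) (n : ℕ) : R :=
  algebraMap ℂ R (Complex.I ^ (1 + f) * (-1) ^ ((1 + f) * n)) *
    ((q ^ (f * ((n * (n + 1) / 2 : ℕ) : ℤ)) : Rˣ) : R)

/-- `ε'_n = i^{1+f} (-1)^{(1+f)n} q^{-f n(n+1)/2}`. -/
def eps' (q : Rˣ) (f : ℤ) (n : ℕ) : R :=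
  algebraMap ℂ R (Complex.I ^ (1 + f) * (-1) ^ ((1 + f) * n)) *
    ((q ^ (-(f * ((n * (n + 1) / 2 : ℕ) : ℤ))) : Rˣ) : R)

/-- The coefficients in the exponent of the gluing vector; the components `a`, `b` are `0`, `1`,
and `Q^{n+1/2}` is `X^(2n+1)`. -/
def glueCoeffs (q : Rˣ) (f : ℤ) : Coeffs 2 (GlueRing R) := fun i j m n =>
  if m = n then
    if i = 0 ∧ j = 1 then
      PowerSeries.X ^ (2 * n + 1) *
        PowerSeries.C (LaurentPolynomial.T 1 * LaurentPolynomial.C (eps q f n))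
    else if i = 1 ∧ j = 0 then
      PowerSeries.X ^ (2 * n + 1) *
        PowerSeries.C (LaurentPolynomial.T (-1) * LaurentPolynomial.C (eps' q f n))
    else 0
  else 0

/-- The gluing vector `|P^f_{ab}⟩`. -/
def glueVector (q : Rˣ) (f : ℤ) : Fock 2 (GlueRing R) := bogoliubov (glueCoeffs q f)

/-- The inner product on `F_a ⊗ F_b` for which the basis states are orthonormal, extended
bilinearly and `Q`-adically: the coefficient of each power of `Q^{1/2}` is summed separately. -/
def pairing (U P : Fock 2 (GlueRing R)) : GlueRing R :=
  PowerSeries.mk fun k => ∑ᶠ T : States 2, PowerSeries.coeff k (U T * P T)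

/-- The inner product `pairing U P` is well defined: only finitely many basis states contribute
to each power of `Q^{1/2}`. -/
def PairingConverges (U P : Fock 2 (GlueRing R)) : Prop :=
  ∀ k : ℕ, (Function.support fun T : States 2 => PowerSeries.coeff k (U T * P T)).Finite

variable {M N : ℕ}

/-- The part of `V ∈ F₁ ⊗ ⋯ ⊗ F_M ⊗ F_a ⊗ F_b` along the basis state `T` of `F₁ ⊗ ⋯ ⊗ F_M`. -/
def slice (V : Fock (M + 2) (GlueRing R)) (T : States M) : Fock 2 (GlueRing R) :=
  fun U => V (Fin.append T U)

/-- The self-gluing `(V, P^f_{ab})`, an inner product over the last two components. -/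
def selfGluing (q : Rˣ) (f : ℤ) (V : Fock (M + 2) (GlueRing R)) : Fock M (GlueRing R) :=
  fun T => pairing (slice V T) (glueVector q f)

/-- The coefficients `A^{ij}_{mn}` with `i, j ∈ {a, b}`. -/
def restrictAB (A : Coeffs (M + 2) (GlueRing R)) : Coeffs 2 (GlueRing R) :=
  fun i j => A (Fin.natAdd M i) (Fin.natAdd M j)

/-- The closed part of the self-gluing of `bogoliubov A`. -/
def closedPart (q : Rˣ) (f : ℤ) (A : Coeffs (M + 2) (GlueRing R)) : GlueRing R :=
  pairing (bogoliubov (restrictAB A)) (glueVector q f)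

/-- The normalized self-gluing of `V`, where `V = bogoliubov A`. -/
def normalizedSelfGluing (q : Rˣ) (f : ℤ) (V : Fock (M + 2) (GlueRing R))
    (A : Coeffs (M + 2) (GlueRing R)) : Fock M (GlueRing R) :=
  Ring.inverse (closedPart q f A) • selfGluing q f V

/-- The tensor product of `V₁ ∈ F₁ ⊗ ⋯ ⊗ F_M ⊗ F_a` and `V₂ ∈ F_{M+1} ⊗ ⋯ ⊗ F_{M+N} ⊗ F_b`, as a
vector of `F₁ ⊗ ⋯ ⊗ F_{M+N} ⊗ F_a ⊗ F_b`: the factor `F_a` is moved past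
`F_{M+1} ⊗ ⋯ ⊗ F_{M+N}` with the Koszul sign. -/
def tensor (V₁ : Fock (M + 1) (GlueRing R)) (V₂ : Fock (N + 1) (GlueRing R)) :
    Fock (M + N + 2) (GlueRing R) := fun T =>
  let T₁ : States M := fun i => T (Fin.castAdd 2 (Fin.castAdd N i))
  let T₂ : States N := fun j => T (Fin.castAdd 2 (Fin.natAdd M j))
  let Ta : Maya := T (Fin.natAdd (M + N) 0)
  let Tb : Maya := T (Fin.natAdd (M + N) 1)
  ((Int.negOnePow (Ta.charge * ∑ j, (T₂ j).charge) : ℤ) : GlueRing R) *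
    (V₁ (Fin.snoc (α := fun _ => Maya) T₁ Ta) * V₂ (Fin.snoc (α := fun _ => Maya) T₂ Tb))

/-- The position of a component of `F₁ ⊗ ⋯ ⊗ F_{M+N} ⊗ F_a ⊗ F_b` in
`F₁ ⊗ ⋯ ⊗ F_M ⊗ F_a` or in `F_{M+1} ⊗ ⋯ ⊗ F_{M+N} ⊗ F_b`. -/
def side (i : Fin (M + N + 2)) : Fin (M + 1) ⊕ Fin (N + 1) :=
  Fin.append (Fin.append (fun i : Fin M => Sum.inl i.castSucc)
    (fun j : Fin N => Sum.inr j.castSucc)) ![Sum.inl (Fin.last M), Sum.inr (Fin.last N)] i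

/-- The coefficients of the tensor product of two Bogoliubov transforms: `A^{ij}_{mn} = 0` unless
`i` and `j` belong to the same factor. -/
def blockCoeffs (A₁ : Coeffs (M + 1) (GlueRing R)) (A₂ : Coeffs (N + 1) (GlueRing R)) :
    Coeffs (M + N + 2) (GlueRing R) := fun i j =>
  match side i, side j with
  | Sum.inl i', Sum.inl j' => A₁ i' j'
  | Sum.inr i', Sum.inr j' => A₂ i' j'
  | _, _ => fun _ _ => 0

end Gluing

end FermionGluing

end

/-!
A Bogoliubov transform is the unique neutral vector with vacuum coefficient one satisfying the
linear relations `ψ^{i*}_{m+1/2} W = ∑_{j,n} A^{ij}_{mn} ψ^{j*}_{-(n+1/2)} W`; these relations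
characterise tensor products of Bogoliubov transforms at once.

Pairing with the gluing vector is a continuous linear map which commutes with the `ψ^{i*}` of the
open components and turns removing a particle of the Dirac sea in a glued component into a multiple
of `Q^{1/2}` times removing a positive one in the other. Substituting the relations of `V` into
themselves therefore converges `Q`-adically, and what is left are relations among the open
components of the glued vector.
-/

noncomputable section

namespace FermionGluing

open scoped Nat LaurentPolynomial PowerSeries

/-! ### Toggling a half-integer -/

section Toggle

variable {N : ℕ}

theorem states_ext {T U : States N} (h : ∀ i r, r ∈ T i ↔ r ∈ U i) : T = U :=
  funext fun i => Maya.ext (Set.ext (h i))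

theorem mem_add {T : States N} {i j : Fin N} {r s : ℤ} :
    s ∈ add T i r j ↔ (i = j ∧ s = r) ∨ s ∈ T j := by
  change s ∈ (add T i r j).carrier ↔ _ ∨ s ∈ (T j).carrier
  obtain rfl | h := eq_or_ne j i
  · simp [add, Maya.insert]
  · simp [add, Function.update_of_ne h, h.symm]

theorem mem_remove {T : States N} {i j : Fin N} {r s : ℤ} :
    s ∈ remove T i r j ↔ ¬(i = j ∧ s = r) ∧ s ∈ T j := by
  change s ∈ (remove T i r j).carrier ↔ _ ∧ s ∈ (T j).carrier
  obtain rfl | h := eq_or_ne j i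
  · simp [remove, Maya.erase, and_comm]
  · simp [remove, Function.update_of_ne h, h.symm]

open Classical in
/-- The state with `r + 1/2` removed from the `i`-th component if it is there, and added
otherwise; up to sign, this is the effect of every mode operator that does not vanish. -/
def toggle (T : States N) (i : Fin N) (r : ℤ) : States N :=
  if r ∈ T i then remove T i r else add T i r

theorem toggle_of_mem {T : States N} {i : Fin N} {r : ℤ} (h : r ∈ T i) :
    toggle T i r = remove T i r := if_pos h

theorem toggle_of_notMem {T : States N} {i : Fin N} {r : ℤ} (h : r ∉ T i) :
    toggle T i r = add T i r := if_neg h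

theorem mem_toggle {T : States N} {i j : Fin N} {r s : ℤ} :
    s ∈ toggle T i r j ↔ (s ∈ T j ↔ ¬(i = j ∧ s = r)) := by
  by_cases hc : i = j ∧ s = r
  · obtain ⟨rfl, rfl⟩ := hc
    by_cases h : s ∈ T i <;> simp [toggle_of_mem, toggle_of_notMem, mem_remove, mem_add, h]
  · by_cases h : r ∈ T i <;> simp [toggle_of_mem, toggle_of_notMem, mem_remove, mem_add, h, hc]

theorem toggle_comm (T : States N) (i j : Fin N) (r s : ℤ) :
    toggle (toggle T i r) j s = toggle (toggle T j s) i r :=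
  states_ext fun k t => by simp only [mem_toggle]; tauto

@[simp]
theorem toggle_toggle (T : States N) (i : Fin N) (r : ℤ) : toggle (toggle T i r) i r = T :=
  states_ext fun k t => by simp only [mem_toggle]; tauto

theorem Maya.charge_insert (A : Maya) {r : ℤ} (h : r ∉ A) :
    (A.insert r).charge = A.charge + 1 := by
  replace h : r ∉ A.carrier := h
  unfold Maya.charge
  obtain hr | hr := lt_or_ge r 0
  · have hparticles : (A.insert r).carrier \ Set.Iio 0 = A.carrier \ Set.Iio 0 :=
      Set.insert_sdiff_of_mem _ hr
    have hholes : Set.Iio 0 \ (A.insert r).carrier = (Set.Iio 0 \ A.carrier) \ {r} := by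
      rw [Set.sdiff_sdiff, Set.union_singleton]; rfl
    have hcard := Set.ncard_sdiff_singleton_add_one (s := Set.Iio 0 \ A.carrier) (a := r)
      ⟨hr, h⟩ A.holes_finite
    rw [hparticles, hholes]
    omega
  · have hparticles : (A.insert r).carrier \ Set.Iio 0
        = Insert.insert r (A.carrier \ Set.Iio 0) :=
      Set.insert_sdiff_of_notMem _ (by simpa using hr)
    have hholes : Set.Iio 0 \ (A.insert r).carrier = Set.Iio 0 \ A.carrier := by
      ext x
      simp only [Maya.insert, Set.mem_sdiff, Set.mem_insert_iff, Set.mem_Iio, not_or]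
      exact ⟨fun hx => ⟨hx.1, hx.2.2⟩, fun hx => ⟨hx.1, by omega, hx.2⟩⟩
    rw [hparticles, hholes, Set.ncard_insert_of_notMem (fun hx => h hx.1) A.particles_finite]
    push_cast
    ring

theorem Maya.finite_above (A : Maya) (r : ℤ) : {a : ℤ | a ∈ A.carrier ∧ r < a}.Finite := by
  refine (A.particles_finite.union (Set.finite_Ioo r 0)).subset fun a ha => ?_
  obtain h | h := lt_or_ge a 0
  · exact Or.inr ⟨ha.2, h⟩
  · exact Or.inl ⟨ha.1, by simpa using h⟩

theorem Maya.above_insert (A : Maya) {r : ℤ} (h : r ∉ A) (s : ℤ) :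
    (A.insert r).above s = A.above s + if s < r then 1 else 0 := by
  unfold Maya.above
  split_ifs with hs
  · rw [← Set.ncard_insert_of_notMem (fun hx => h hx.1) (A.finite_above s)]
    congr 1
    ext x
    simp only [Maya.insert, Set.mem_insert_iff, Set.mem_ofPred_eq]
    grind
  · congr 1
    ext x
    simp only [Maya.insert, Set.mem_insert_iff, Set.mem_ofPred_eq]
    grind

theorem charge_add {T : States N} {i : Fin N} {r : ℤ} (h : r ∉ T i) (j : Fin N) :
    (add T i r j).charge = (T j).charge + if i = j then 1 else 0 := by
  obtain rfl | hj := eq_or_ne j i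
  · simp [add, Maya.charge_insert _ h]
  · simp [add, Function.update_of_ne hj, hj.symm]

theorem above_add {T : States N} {i : Fin N} {r : ℤ} (h : r ∉ T i) (j : Fin N) (s : ℤ) :
    (add T i r j).above s = (T j).above s + if i = j ∧ s < r then 1 else 0 := by
  obtain rfl | hj := eq_or_ne j i
  · simp [add, Maya.above_insert _ h]
  · simp [add, Function.update_of_ne hj, hj.symm]

theorem sgn_add_eq {T : States N} {i : Fin N} {r : ℤ} (h : r ∉ T i) (j : Fin N) (s : ℤ) :
    sgn (add T i r) j s = if i < j ∨ (i = j ∧ s < r) then - sgn T j s else sgn T j s := by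
  unfold sgn
  simp only [charge_add h, above_add h, Finset.sum_add_distrib, Finset.sum_ite_eq,
    Finset.mem_Iio]
  split_ifs
  all_goals first
    | (exfalso; omega)
    | (push_cast; rw [← Int.negOnePow_succ]; congr 1; ring)
    | (push_cast; congr 1; ring)

theorem sgn_toggle (T : States N) (i : Fin N) (r : ℤ) (j : Fin N) (s : ℤ) :
    sgn (toggle T i r) j s = if i < j ∨ (i = j ∧ s < r) then - sgn T j s else sgn T j s := by
  by_cases h : r ∈ T i
  · have hT := sgn_add_eq (notMem_remove_self T i r) j s
    rw [add_remove T i r h] at hT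
    rw [toggle_of_mem h, hT]
    split_ifs <;> simp
  · rw [toggle_of_notMem h, sgn_add_eq h]

theorem sgn_toggle_self (T : States N) (i : Fin N) (r : ℤ) :
    sgn (toggle T i r) i r = sgn T i r := by
  simp [sgn_toggle]

theorem sgn_mul_sgn_toggle (T : States N) {i j : Fin N} {r s : ℤ} (h : ¬(i = j ∧ r = s)) :
    sgn T i r * sgn (toggle T i r) j s = -(sgn T j s * sgn (toggle T j s) i r) := by
  rw [sgn_toggle, sgn_toggle]
  have horder : (i < j ∨ (i = j ∧ s < r)) ↔ ¬(j < i ∨ (j = i ∧ r < s)) := by omega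
  by_cases hc : j < i ∨ (j = i ∧ r < s)
  · rw [if_pos hc, if_neg (fun h => horder.1 h hc), mul_neg, neg_neg, mul_comm]
  · rw [if_neg hc, if_pos (horder.2 hc), mul_neg, mul_comm]

theorem sgn_mul_self (T : States N) (i : Fin N) (r : ℤ) (S : Type*) [Ring S] :
    ((sgn T i r : ℤ) : S) * ((sgn T i r : ℤ) : S) = 1 := by
  rw [← Int.cast_mul, ← Units.val_mul, Int.units_mul_self]
  simp

end Toggle

/-! ### The mode operators -/

section Modes

variable {N : ℕ} {S : Type*} [CommRing S]

/-- The modes `ψ^i_{r+1/2}` (`true`) and `ψ^{i*}_{r+1/2}` (`false`) under one name, so that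
statements about both kinds can be proved at once. -/
def fermion (b : Bool) : Fin N → ℤ → Fock N S →ₗ[S] Fock N S :=
  match b with
  | true => psi
  | false => psiStar

open Classical in
theorem fermion_apply (b : Bool) (i : Fin N) (r : ℤ) (V : Fock N S) (T : States N) :
    fermion b i r V T
      = if (r ∈ T i ↔ b = true) then ((sgn T i r : ℤ) : S) * V (toggle T i r) else 0 := by
  cases b
  · change (if r ∈ T i then 0 else _ * V (add T i r)) = _
    by_cases h : r ∈ T i <;> simp [h, toggle_of_notMem]
  · change (if r ∈ T i then _ * V (remove T i r) else 0) = _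
    by_cases h : r ∈ T i <;> simp [h, toggle_of_mem]

theorem fermion_anticomm (b c : Bool) (i j : Fin N) (r s : ℤ) (V : Fock N S) :
    fermion b i r (fermion c j s V)
      = -fermion c j s (fermion b i r V) + if i = j ∧ r = s ∧ b ≠ c then V else 0 := by
  ext T
  by_cases h : i = j ∧ r = s
  · obtain ⟨rfl, rfl⟩ := h
    by_cases hr : r ∈ T i <;> cases b <;> cases c <;>
      simp [fermion_apply, mem_toggle, hr, sgn_toggle_self, ← mul_assoc, sgn_mul_self]
  · have hsr : ¬(i = j ∧ s = r) := fun hij => h ⟨hij.1, hij.2.symm⟩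
    have hrs : ¬(j = i ∧ r = s) := fun hji => h ⟨hji.1.symm, hji.2⟩
    have hδ : ¬(i = j ∧ r = s ∧ b ≠ c) := fun hij => h ⟨hij.1, hij.2.1⟩
    have hsgn : ((sgn T i r : ℤ) : S) * ((sgn (toggle T i r) j s : ℤ) : S)
        = -(((sgn T j s : ℤ) : S) * ((sgn (toggle T j s) i r : ℤ) : S)) := by
      exact_mod_cast congrArg (fun u : ℤˣ => ((u : ℤ) : S)) (sgn_mul_sgn_toggle T h)
    have hj : s ∈ toggle T i r j ↔ s ∈ T j := by simp [mem_toggle, hsr]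
    have hi : r ∈ toggle T j s i ↔ r ∈ T i := by simp [mem_toggle, hrs]
    simp only [Pi.add_apply, Pi.neg_apply, fermion_apply, hδ, if_false, Pi.zero_apply,
      add_zero]
    by_cases hr : r ∈ T i ↔ b = true <;> by_cases hs : s ∈ T j ↔ c = true <;>
      simp only [hi, hj, hr, hs, if_true, if_false, mul_zero, neg_zero]
    rw [← mul_assoc, ← mul_assoc, hsgn, toggle_comm, neg_mul]

theorem psi_psi (i j : Fin N) (r s : ℤ) (V : Fock N S) :
    psi i r (psi j s V) = -psi j s (psi i r V) :=
  (fermion_anticomm true true i j r s V).trans (by simp [fermion])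

theorem psiStar_psiStar (i j : Fin N) (r s : ℤ) (V : Fock N S) :
    psiStar i r (psiStar j s V) = -psiStar j s (psiStar i r V) :=
  (fermion_anticomm false false i j r s V).trans (by simp [fermion])

open Classical in
theorem psiStar_psi (i j : Fin N) (r s : ℤ) (V : Fock N S) :
    psiStar i r (psi j s V) = -psi j s (psiStar i r V) + if i = j ∧ r = s then V else 0 :=
  (fermion_anticomm false true i j r s V).trans (by simp [fermion])

open Classical in
theorem psi_psiStar (i j : Fin N) (r s : ℤ) (V : Fock N S) :
    psi i r (psiStar j s V) = -psiStar j s (psi i r V) + if i = j ∧ r = s then V else 0 :=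
  (fermion_anticomm true false i j r s V).trans (by simp [fermion])

theorem apply_eq_sgn_mul_fermion {b : Bool} {i : Fin N} {r : ℤ} {T : States N}
    (h : ¬(r ∈ T i ↔ b = true)) (V : Fock N S) :
    V T = ((sgn T i r : ℤ) : S) * fermion b i r V (toggle T i r) := by
  have h' : r ∈ toggle T i r i ↔ b = true := by
    rw [mem_toggle]; tauto
  rw [fermion_apply, if_pos h', toggle_toggle, sgn_toggle_self, ← mul_assoc, sgn_mul_self, one_mul]

open Classical in
theorem vac_apply_of_ne {T : States N} (h : T ≠ fun _ => Maya.vacuum) :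
    (vac : Fock N S) T = 0 := Pi.single_eq_of_ne h _

theorem fermion_vac (b : Bool) {r : ℤ} (h : r < 0 ↔ b = true) (i : Fin N) :
    fermion b i r (vac : Fock N S) = 0 := by
  ext T
  rw [fermion_apply]
  split_ifs with hT
  · have hne : toggle T i r ≠ fun _ => Maya.vacuum := fun hvac => by
      have hmem : r ∈ toggle T i r i ↔ r < 0 := by rw [hvac]; rfl
      rw [mem_toggle] at hmem
      tauto
    rw [vac_apply_of_ne hne, mul_zero, Pi.zero_apply]
  · rfl

theorem psiStar_natCast_vac (i : Fin N) (m : ℕ) : psiStar i (m : ℤ) (vac : Fock N S) = 0 :=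
  fermion_vac false (by simp) i

theorem psi_negSucc_vac (i : Fin N) (n : ℕ) : psi i (-(n : ℤ) - 1) (vac : Fock N S) = 0 :=
  fermion_vac true (by simp; omega) i

variable [TopologicalSpace S] [IsTopologicalRing S]

theorem continuous_fermion (b : Bool) (i : Fin N) (r : ℤ) :
    Continuous (fermion b i r : Fock N S →ₗ[S] Fock N S) := by
  refine continuous_pi fun T => ?_
  simp only [fermion_apply]
  split_ifs <;> fun_prop

theorem continuous_psi (i : Fin N) (r : ℤ) : Continuous (psi i r : Fock N S →ₗ[S] Fock N S) :=
  continuous_fermion true i r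

theorem continuous_psiStar (i : Fin N) (r : ℤ) :
    Continuous (psiStar i r : Fock N S →ₗ[S] Fock N S) :=
  continuous_fermion false i r

end Modes

/-! ### The quadratic exponent -/

section Exponent

variable {N : ℕ} {S : Type*} [CommRing S]

theorem finite_particles (T : States N) : {x : Fin N × ℕ | (x.2 : ℤ) ∈ T x.1}.Finite := by
  refine (Set.finite_iUnion fun i => ((T i).particles_finite.preimage
    (Nat.cast_injective (R := ℤ)).injOn).image (Prod.mk i)).subset ?_
  rintro ⟨i, m⟩ hm
  exact Set.mem_iUnion.2 ⟨i, m, ⟨hm, by simp⟩, rfl⟩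

theorem finite_holes (T : States N) : {x : Fin N × ℕ | -(x.2 : ℤ) - 1 ∉ T x.1}.Finite := by
  have hinj : Function.Injective fun n : ℕ => -(n : ℤ) - 1 := fun m n h => by
    simpa using h
  refine (Set.finite_iUnion fun i => ((T i).holes_finite.preimage
    hinj.injOn).image (Prod.mk i)).subset ?_
  rintro ⟨i, n⟩ hn
  exact Set.mem_iUnion.2 ⟨i, n, ⟨by simp only [Set.mem_Iio]; omega, hn⟩, rfl⟩

/-- The finitely many indices of terms of the exponent that can reach the state `T`, whatever the
vector they act on. -/
def quadIndices (T : States N) : Finset (Fin N × Fin N × ℕ × ℕ) :=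
  ((finite_particles T).toFinset ×ˢ (finite_holes T).toFinset).map
    (Equiv.prodProdProdComm _ _ _ _ |>.trans (Equiv.prodAssoc _ _ _)).toEmbedding

theorem quadTerm_eq_zero (A : Coeffs N S) (V : Fock N S) {T : States N}
    {p : Fin N × Fin N × ℕ × ℕ} (hp : p ∉ quadIndices T) : quadTerm A V p T = 0 := by
  contrapose! hp
  obtain ⟨hm, hn, -⟩ := quadTerm_ne_zero hp
  simp only [quadIndices, Finset.mem_map, Finset.mem_product, Set.Finite.mem_toFinset,
    Set.mem_ofPred_eq]
  exact ⟨((p.1, p.2.2.1), (p.2.1, p.2.2.2)), ⟨hm, hn⟩, rfl⟩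

theorem quad_apply (A : Coeffs N S) (V : Fock N S) (T : States N) :
    quad A V T = ∑ p ∈ quadIndices T, quadTerm A V p T :=
  finsum_eq_sum_of_support_subset _ fun p hp => by
    by_contra hp'
    exact hp (quadTerm_eq_zero A V hp')

theorem quadTerm_add (A : Coeffs N S) (V W : Fock N S) (p : Fin N × Fin N × ℕ × ℕ) :
    quadTerm A (V + W) p = quadTerm A V p + quadTerm A W p := by
  simp only [quadTerm, map_add, smul_add]

theorem quadTerm_smul (A : Coeffs N S) (c : S) (V : Fock N S) (p : Fin N × Fin N × ℕ × ℕ) :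
    quadTerm A (c • V) p = c • quadTerm A V p := by
  simp only [quadTerm, map_smul]
  exact smul_comm _ _ _

/-- The exponent `quad A` as an element of the endomorphism ring of the Fock space, where
commutators and powers are available. -/
def quadOp (A : Coeffs N S) : Module.End S (Fock N S) where
  toFun := quad A
  map_add' V W := by
    ext T
    simp only [Pi.add_apply, quad_apply, quadTerm_add, Finset.sum_add_distrib]
  map_smul' c V := by
    ext T
    simp only [Pi.smul_apply, quad_apply, quadTerm_smul, Finset.smul_sum, RingHom.id_apply]

theorem quadOp_pow_apply (A : Coeffs N S) (k : ℕ) (V : Fock N S) :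
    (quadOp A ^ k) V = (quad A)^[k] V := Module.End.pow_apply _ _ _

variable [TopologicalSpace S]

theorem hasSum_quadTerm (A : Coeffs N S) (V : Fock N S) :
    HasSum (quadTerm A V) (quadOp A V) :=
  Pi.hasSum.2 fun T => by
    change HasSum _ (quad A V T)
    rw [quad_apply]
    exact hasSum_sum_of_ne_finset_zero fun p hp => quadTerm_eq_zero A V hp

theorem continuous_quadOp [IsTopologicalRing S] (A : Coeffs N S) : Continuous (quadOp A) := by
  refine continuous_pi fun T => ?_
  change Continuous fun V => quad A V T
  simp only [quad_apply]
  refine continuous_finsetSum _ fun p _ => ?_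
  exact continuous_const.mul ((continuous_apply T).comp
    ((continuous_psi _ _).comp (continuous_psiStar _ _)))

end Exponent

/-! ### Commutators with the exponential -/

section Commutator

variable {N : ℕ} {S : Type*} [CommRing S] [Algebra ℂ S]

theorem bogoliubov_apply (A : Coeffs N S) (T : States N) :
    bogoliubov A T = ((particles T)! : ℂ)⁻¹ • (quad A)^[particles T] vac T := by
  refine finsum_eq_single _ _ fun k hk => ?_
  by_contra h
  refine hk (quad_iterate_vac_ne_zero A k T fun hzero => h ?_).symm
  rw [hzero, smul_zero]

variable [TopologicalSpace S]

theorem hasSum_bogoliubov (A : Coeffs N S) :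
    HasSum (fun k : ℕ => (k ! : ℂ)⁻¹ • (quadOp A ^ k) vac) (bogoliubov A) := by
  refine Pi.hasSum.2 fun T => ?_
  rw [bogoliubov_apply, ← quadOp_pow_apply, ← Pi.smul_apply]
  refine hasSum_single _ fun k hk => ?_
  rw [Pi.smul_apply, quadOp_pow_apply,
    not_imp_comm.1 (quad_iterate_vac_ne_zero A k T) hk.symm, smul_zero]

variable [IsTopologicalRing S] [T2Space S]

theorem map_bogoliubov_of_commute {A : Coeffs N S} {D : Module.End S (Fock N S)}
    (hD : Continuous D) (hvac : D vac = 0) (hcomm : Commute ⁅D, quadOp A⁆ (quadOp A)) :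
    D (bogoliubov A) = ⁅D, quadOp A⁆ (bogoliubov A) := by
  set C := ⁅D, quadOp A⁆ with hC
  have hCcont : Continuous C :=
    (hD.comp (continuous_quadOp A)).sub ((continuous_quadOp A).comp hD)
  have hpow (k : ℕ) : D ((quadOp A ^ (k + 1)) vac) = (k + 1 : ℕ) • C ((quadOp A ^ k) vac) := by
    have hDC : D * quadOp A = C + quadOp A * D := by rw [hC, Ring.lie_def]; abel
    induction k with
    | zero =>
      have := congrArg (fun E : Module.End S (Fock N S) => E vac) hDC
      simpa [hvac] using this
    | succ k ih =>
      calc D ((quadOp A ^ (k + 2)) vac)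
          = (D * quadOp A) ((quadOp A ^ (k + 1)) vac) := by rw [pow_succ']; rfl
        _ = C ((quadOp A ^ (k + 1)) vac) + quadOp A (D ((quadOp A ^ (k + 1)) vac)) := by
          rw [hDC]; rfl
        _ = C ((quadOp A ^ (k + 1)) vac) + (k + 1 : ℕ) • (quadOp A * C) ((quadOp A ^ k) vac) := by
          rw [ih, map_nsmul]; rfl
        _ = (k + 1 + 1 : ℕ) • C ((quadOp A ^ (k + 1)) vac) := by
          rw [← hcomm.eq, succ_nsmul' _ (k + 1), pow_succ']; rfl
  have hD_sum : HasSum (fun k => D ((k ! : ℂ)⁻¹ • (quadOp A ^ k) vac)) (D (bogoliubov A)) :=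
    (hasSum_bogoliubov A).map D hD
  have hC_sum : HasSum (fun k => C ((k ! : ℂ)⁻¹ • (quadOp A ^ k) vac)) (C (bogoliubov A)) :=
    (hasSum_bogoliubov A).map C hCcont
  have hshift (k : ℕ) : D (((k + 1)! : ℂ)⁻¹ • (quadOp A ^ (k + 1)) vac)
      = C ((k ! : ℂ)⁻¹ • (quadOp A ^ k) vac) := by
    have hk : ((k + 1 : ℕ) : ℂ) ≠ 0 := by exact_mod_cast k.succ_ne_zero
    rw [LinearMap.map_smul_of_tower, LinearMap.map_smul_of_tower, hpow, ← Nat.cast_smul_eq_nsmul ℂ,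
      smul_smul, Nat.factorial_succ, Nat.cast_mul, mul_inv_rev, inv_mul_cancel_right₀ hk]
  rw [← hasSum_nat_add_iff' 1] at hD_sum
  simp only [hshift, Finset.sum_range_one, pow_zero, Module.End.one_apply,
    LinearMap.map_smul_of_tower, hvac, smul_zero, sub_zero] at hD_sum
  refine hD_sum.unique ?_
  simpa only [LinearMap.map_smul_of_tower] using hC_sum

omit [Algebra ℂ S] [IsTopologicalRing S] in
theorem commute_quadOp {A : Coeffs N S} {D : Module.End S (Fock N S)} (hD : Continuous D)
    (h : ∀ p V, D (quadTerm A V p) = quadTerm A (D V) p) : Commute D (quadOp A) :=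
  LinearMap.ext fun V => by
    have hsum := (hasSum_quadTerm A V).map D hD
    simp only [Function.comp_def, h] at hsum
    exact hsum.unique (hasSum_quadTerm A (D V))

theorem hasSum_map_bogoliubov {A : Coeffs N S} {D : Module.End S (Fock N S)} {ι : Type*}
    {e : ι → Fin N × Fin N × ℕ × ℕ} {E : ι → Module.End S (Fock N S)}
    (hD : Continuous D) (hvac : D vac = 0) (he : Function.Injective e)
    (hE : ∀ x V, D (quadTerm A V (e x)) = quadTerm A (D V) (e x) + E x V)
    (hrest : ∀ p ∉ Set.range e, ∀ V, D (quadTerm A V p) = quadTerm A (D V) p)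
    (hcomm : ∀ x, Commute (E x) (quadOp A)) :
    HasSum (fun x => E x (bogoliubov A)) (D (bogoliubov A)) := by
  have hsum (V : Fock N S) : HasSum (fun x => E x V) (⁅D, quadOp A⁆ V) := by
    have h := (he.hasSum_iff fun p hp => sub_eq_zero.2 (hrest p hp V)).2
      (((hasSum_quadTerm A V).map D hD).sub (hasSum_quadTerm A (D V)))
    simp only [Function.comp_def, hE, add_sub_cancel_left] at h
    exact h
  rw [map_bogoliubov_of_commute hD hvac]
  · exact hsum _
  · refine LinearMap.ext fun V => (hsum (quadOp A V)).unique ?_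
    have h := (hsum V).map (quadOp A) (continuous_quadOp A)
    have hE' (x) : quadOp A (E x V) = E x (quadOp A V) :=
      congrArg (fun F : Module.End S (Fock N S) => F V) (hcomm x).eq.symm
    simp only [Function.comp_def, hE'] at h
    exact h

end Commutator

/-! ### Linear relations satisfied by a Bogoliubov transform -/

section Relations

variable {N : ℕ} {S : Type*} [CommRing S]

open Classical in
theorem psiStar_quadTerm (A : Coeffs N S) (i : Fin N) (r : ℤ) (V : Fock N S)
    (p : Fin N × Fin N × ℕ × ℕ) :
    psiStar i r (quadTerm A V p) = quadTerm A (psiStar i r V) p +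
      if i = p.1 ∧ r = p.2.2.1 then
        A p.1 p.2.1 p.2.2.1 p.2.2.2 • psiStar p.2.1 (-(p.2.2.2 : ℤ) - 1) V
      else 0 := by
  rw [quadTerm, map_smul, psiStar_psi, psiStar_psiStar, map_neg, neg_neg, smul_add, smul_ite,
    smul_zero, quadTerm]

open Classical in
theorem psi_quadTerm (A : Coeffs N S) (j : Fin N) (s : ℤ) (V : Fock N S)
    (p : Fin N × Fin N × ℕ × ℕ) :
    psi j s (quadTerm A V p) = quadTerm A (psi j s V) p +
      if p.2.1 = j ∧ -(p.2.2.2 : ℤ) - 1 = s then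
        -A p.1 p.2.1 p.2.2.1 p.2.2.2 • psi p.1 p.2.2.1 V
      else 0 := by
  have hswap : psi j s (psiStar p.2.1 (-(p.2.2.2 : ℤ) - 1) V) =
      -psiStar p.2.1 (-(p.2.2.2 : ℤ) - 1) (psi j s V)
        + if p.2.1 = j ∧ -(p.2.2.2 : ℤ) - 1 = s then V else 0 := by
    rw [psiStar_psi]; abel
  rw [quadTerm, map_smul, psi_psi, hswap, map_add, map_neg, neg_add, neg_neg, smul_add,
    apply_ite (psi p.1 _), map_zero, quadTerm]
  split_ifs <;> simp only [neg_smul, smul_neg, neg_zero, smul_zero]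

variable [TopologicalSpace S] [IsTopologicalRing S] [T2Space S] [Algebra ℂ S]

theorem hasSum_psiStar_bogoliubov (A : Coeffs N S) (i : Fin N) (m : ℕ) :
    HasSum (fun x : Fin N × ℕ => A i x.1 m x.2 • psiStar x.1 (-(x.2 : ℤ) - 1) (bogoliubov A))
      (psiStar i (m : ℤ) (bogoliubov A)) := by
  let e (x : Fin N × ℕ) : Fin N × Fin N × ℕ × ℕ := (i, x.1, m, x.2)
  let E (x : Fin N × ℕ) : Module.End S (Fock N S) :=
    A i x.1 m x.2 • psiStar x.1 (-(x.2 : ℤ) - 1)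
  have he : Function.Injective e := fun x y h => by
    simp only [e, Prod.mk.injEq] at h
    exact Prod.ext h.2.1 h.2.2.2
  have hE (x V) : psiStar i m (quadTerm A V (e x))
      = quadTerm A (psiStar i m V) (e x) + E x V := by
    rw [psiStar_quadTerm, if_pos ⟨rfl, rfl⟩]
    rfl
  have hrest (p) (hp : p ∉ Set.range e) (V) :
      psiStar i m (quadTerm A V p) = quadTerm A (psiStar i m V) p := by
    rw [psiStar_quadTerm, if_neg, add_zero]
    rintro ⟨rfl, hm⟩
    exact hp ⟨(p.2.1, p.2.2.2), by simp only [e, Nat.cast_inj.1 hm]⟩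
  have hcomm (x) : Commute (E x) (quadOp A) := by
    have hterm (p V) : psiStar x.1 (-(x.2 : ℤ) - 1) (quadTerm A V p)
        = quadTerm A (psiStar x.1 (-(x.2 : ℤ) - 1) V) p := by
      rw [psiStar_quadTerm, if_neg (by omega), add_zero]
    exact (commute_quadOp (continuous_psiStar _ _) hterm).smul_left _
  exact (hasSum_map_bogoliubov (continuous_psiStar i m) (psiStar_natCast_vac i m) he hE hrest
    hcomm :)

theorem hasSum_psi_bogoliubov (A : Coeffs N S) (j : Fin N) (n : ℕ) :
    HasSum (fun x : Fin N × ℕ => -A x.1 j x.2 n • psi x.1 (x.2 : ℤ) (bogoliubov A))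
      (psi j (-(n : ℤ) - 1) (bogoliubov A)) := by
  let e (x : Fin N × ℕ) : Fin N × Fin N × ℕ × ℕ := (x.1, j, x.2, n)
  let E (x : Fin N × ℕ) : Module.End S (Fock N S) := -A x.1 j x.2 n • psi x.1 (x.2 : ℤ)
  have he : Function.Injective e := fun x y h => by
    simp only [e, Prod.mk.injEq] at h
    exact Prod.ext h.1 h.2.2.1
  have hE (x V) : psi j (-(n : ℤ) - 1) (quadTerm A V (e x))
      = quadTerm A (psi j (-(n : ℤ) - 1) V) (e x) + E x V := by
    rw [psi_quadTerm, if_pos ⟨rfl, rfl⟩]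
    rfl
  have hrest (p) (hp : p ∉ Set.range e) (V) :
      psi j (-(n : ℤ) - 1) (quadTerm A V p) = quadTerm A (psi j (-(n : ℤ) - 1) V) p := by
    rw [psi_quadTerm, if_neg, add_zero]
    rintro ⟨rfl, hn⟩
    exact hp ⟨(p.1, p.2.2.1), by simp only [e, show n = p.2.2.2 by omega]⟩
  have hcomm (x) : Commute (E x) (quadOp A) := by
    have hterm (p V) : psi x.1 (x.2 : ℤ) (quadTerm A V p)
        = quadTerm A (psi x.1 (x.2 : ℤ) V) p := by
      rw [psi_quadTerm, if_neg (by omega), add_zero]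
    exact (commute_quadOp (continuous_psi _ _) hterm).smul_left _
  exact (hasSum_map_bogoliubov (continuous_psi j _) (psi_negSucc_vac j n) he hE hrest hcomm :)

end Relations

/-! ### Bogoliubov transforms as the neutral solutions of the particle relations -/

section Uniqueness

variable {N : ℕ} {S : Type*} [CommRing S]

/-- The linear relations `ψ^{i*}_{m+1/2} W = ∑_{j,n} A^{ij}_{mn} ψ^{j*}_{-(n+1/2)} W`, expressing
the removal of a particle through removals of elements of the Dirac sea. -/
def ParticleRelations [TopologicalSpace S] (A : Coeffs N S) (W : Fock N S) : Prop :=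
  ∀ (i : Fin N) (m : ℕ),
    HasSum (fun x : Fin N × ℕ => A i x.1 m x.2 • psiStar x.1 (-(x.2 : ℤ) - 1) W)
      (psiStar i (m : ℤ) W)

/-- Vectors of total charge zero. -/
def IsNeutral (W : Fock N S) : Prop := ∀ T, W T ≠ 0 → ∑ i, (T i).charge = 0

theorem Maya.charge_vacuum : Maya.vacuum.charge = 0 := by
  simp [Maya.charge, Maya.vacuum]

theorem particles_vacuum : particles (fun _ : Fin N => Maya.vacuum) = 0 := by
  simp [particles, Maya.vacuum]

theorem exists_mem_of_particles_ne_zero {T : States N} (h : particles T ≠ 0) :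
    ∃ (i : Fin N) (m : ℕ), (m : ℤ) ∈ T i := by
  obtain ⟨i, -, hi⟩ := Finset.exists_ne_zero_of_sum_ne_zero h
  obtain ⟨r, hr, hr0⟩ := Set.nonempty_of_ncard_ne_zero hi
  lift r to ℕ using not_lt.1 hr0
  exact ⟨i, r, hr⟩

theorem eq_vacuum_of_neutral {T : States N} (hparticles : particles T = 0)
    (hcharge : ∑ i, (T i).charge = 0) : T = fun _ => Maya.vacuum := by
  have hp (i) : ((T i).carrier \ Set.Iio 0).ncard = 0 :=
    Finset.sum_eq_zero_iff.1 hparticles i (Finset.mem_univ i)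
  have hh (i) : (Set.Iio 0 \ (T i).carrier).ncard = 0 := by
    simp only [Maya.charge, hp, Nat.cast_zero, zero_sub, Finset.sum_neg_distrib, neg_eq_zero,
      ← Nat.cast_sum, Nat.cast_eq_zero] at hcharge
    exact Finset.sum_eq_zero_iff.1 hcharge i (Finset.mem_univ i)
  refine funext fun i => Maya.ext (Set.Subset.antisymm ?_ ?_)
  · exact Set.sdiff_eq_empty.1 ((Set.ncard_eq_zero (T i).particles_finite).1 (hp i))
  · exact Set.sdiff_eq_empty.1 ((Set.ncard_eq_zero (T i).holes_finite).1 (hh i))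

theorem sum_charge_add {T : States N} {i : Fin N} {r : ℤ} (h : r ∉ T i) :
    ∑ j, (add T i r j).charge = ∑ j, (T j).charge + 1 := by
  simp [charge_add h, Finset.sum_add_distrib]

theorem isNeutral_quad {V : Fock N S} (hV : IsNeutral V) (A : Coeffs N S) :
    IsNeutral (quad A V) := fun T hT => by
  obtain ⟨⟨i, j, m, n⟩, hp⟩ : ∃ p, quadTerm A V p T ≠ 0 := by
    by_contra! h
    exact hT (by simp [quad, h])
  obtain ⟨hm, hn, hne⟩ := quadTerm_ne_zero hp
  have hadd := sum_charge_add (T := remove T i m) fun h => hn (mem_remove.1 h).2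
  have hremove := sum_charge_add (notMem_remove_self T i m)
  rw [add_remove T i m hm] at hremove
  rw [hremove, ← hadd, hV _ hne]

theorem isNeutral_vac : IsNeutral (vac : Fock N S) := fun T hT => by
  simp [not_imp_comm.1 vac_apply_of_ne hT, Maya.charge_vacuum]

section Bogoliubov

variable [Algebra ℂ S]

theorem isNeutral_bogoliubov (A : Coeffs N S) : IsNeutral (bogoliubov A) := fun T hT => by
  have hiterate (k : ℕ) : IsNeutral ((quad A)^[k] vac) :=
    Function.Iterate.rec IsNeutral isNeutral_vac (fun _ h => isNeutral_quad h A) k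
  refine hiterate (particles T) T fun hzero => hT ?_
  rw [bogoliubov_apply, hzero, smul_zero]

theorem bogoliubov_vacuum (A : Coeffs N S) : bogoliubov A (fun _ => Maya.vacuum) = 1 := by
  rw [bogoliubov_apply, particles_vacuum]
  simp [vac]

end Bogoliubov

variable [TopologicalSpace S] [T2Space S]

theorem ParticleRelations.eq_zero {A : Coeffs N S} {W : Fock N S} (hW : ParticleRelations A W)
    (hparticles : ∀ T, particles T = 0 → W T = 0) : W = 0 := by
  suffices h : ∀ k T, particles T = k → W T = 0 from funext fun T => h _ T rfl
  intro k
  induction k with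
  | zero => exact hparticles
  | succ k ih =>
    intro T hT
    obtain ⟨i, m, hm⟩ := exists_mem_of_particles_ne_zero (T := T) (by omega)
    have hterm (x : Fin N × ℕ) :
        (A i x.1 m x.2 • psiStar x.1 (-(x.2 : ℤ) - 1) W) (toggle T i m) = 0 := by
      change _ * fermion false _ _ W _ = 0
      rw [fermion_apply]
      split_ifs with hx
      · have hstate := particles_quad T i x.1 m x.2 hm
        rw [toggle_of_mem hm] at hx ⊢
        rw [toggle_of_notMem (by simpa using hx), ih _ (by omega), mul_zero, mul_zero]
      · exact mul_zero _
    have hzero : psiStar i m W (toggle T i m) = 0 :=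
      (Pi.hasSum.1 (hW i m) (toggle T i m)).unique (by simp only [hterm, hasSum_zero])
    exact (apply_eq_sgn_mul_fermion (b := false) (by simpa using hm) W).trans
      ((congrArg _ hzero).trans (mul_zero _))

variable [Algebra ℂ S] [IsTopologicalRing S]

theorem particleRelations_bogoliubov (A : Coeffs N S) : ParticleRelations A (bogoliubov A) :=
  hasSum_psiStar_bogoliubov A

theorem ParticleRelations.eq_smul_bogoliubov {A : Coeffs N S} {W : Fock N S}
    (hW : ParticleRelations A W) (hneutral : IsNeutral W) :
    W = W (fun _ => Maya.vacuum) • bogoliubov A := by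
  rw [← sub_eq_zero]
  refine ParticleRelations.eq_zero (A := A) (fun i m => ?_) fun T hT => ?_
  · have hsum := (hW i m).sub
      ((particleRelations_bogoliubov A i m).const_smul (W fun _ => Maya.vacuum))
    simp only [smul_comm (W fun _ => Maya.vacuum), ← smul_sub, ← map_smul, ← map_sub] at hsum
    simpa only [map_smul] using hsum
  · obtain rfl | hne := eq_or_ne T fun _ => Maya.vacuum
    · simp [bogoliubov_vacuum]
    · have hcharge : ∑ i, (T i).charge ≠ 0 := mt (eq_vacuum_of_neutral hT) hne
      have hzero := not_imp_comm.1 (hneutral T) hcharge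
      have hzero' := not_imp_comm.1 (isNeutral_bogoliubov A T) hcharge
      simp [hzero, hzero']

end Uniqueness

/-! ### Tensor products -/

section TensorPositions

variable {M N : ℕ}

/-- The position in `F₁ ⊗ ⋯ ⊗ F_{M+N} ⊗ F_a ⊗ F_b` of a component of `F₁ ⊗ ⋯ ⊗ F_M ⊗ F_a`. -/
def leftPos : Fin (M + 1) → Fin (M + N + 2) :=
  Fin.snoc (fun i => Fin.castAdd 2 (Fin.castAdd N i)) (Fin.natAdd (M + N) 0)

/-- The position in `F₁ ⊗ ⋯ ⊗ F_{M+N} ⊗ F_a ⊗ F_b` of a component of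
`F_{M+1} ⊗ ⋯ ⊗ F_{M+N} ⊗ F_b`. -/
def rightPos : Fin (N + 1) → Fin (M + N + 2) :=
  Fin.snoc (fun j => Fin.castAdd 2 (Fin.natAdd M j)) (Fin.natAdd (M + N) 1)

theorem val_leftPos (i : Fin (M + 1)) :
    (leftPos (N := N) i : ℕ) = if (i : ℕ) = M then M + N else i := by
  cases i using Fin.lastCases with
  | last => simp [leftPos]
  | cast i => simp [leftPos, i.isLt.ne]

theorem val_rightPos (j : Fin (N + 1)) :
    (rightPos (M := M) j : ℕ) = if (j : ℕ) = N then M + N + 1 else M + j := by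
  cases j using Fin.lastCases with
  | last => simp [rightPos]
  | cast j => simp [rightPos, j.isLt.ne]

theorem leftPos_lt_leftPos {i i' : Fin (M + 1)} :
    leftPos (N := N) i < leftPos i' ↔ i < i' := by
  simp only [Fin.lt_def, val_leftPos]
  split_ifs <;> omega

theorem rightPos_lt_rightPos {j j' : Fin (N + 1)} :
    rightPos (M := M) j < rightPos j' ↔ j < j' := by
  simp only [Fin.lt_def, val_rightPos]
  split_ifs <;> omega

theorem rightPos_lt_leftPos {i : Fin (M + 1)} {j : Fin (N + 1)} :
    rightPos j < leftPos i ↔ i = Fin.last M ∧ j ≠ Fin.last N := by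
  simp only [Fin.lt_def, val_leftPos, val_rightPos, Fin.ext_iff, Fin.val_last, ne_eq]
  split_ifs <;> omega

theorem leftPos_lt_rightPos {i : Fin (M + 1)} {j : Fin (N + 1)} :
    leftPos i < rightPos j ↔ j = Fin.last N ∨ i ≠ Fin.last M := by
  simp only [Fin.lt_def, val_leftPos, val_rightPos, Fin.ext_iff, Fin.val_last, ne_eq]
  split_ifs <;> omega

/-- `side` as an equivalence, with inverse `leftPos` and `rightPos`. -/
def sideEquiv : Fin (M + N + 2) ≃ Fin (M + 1) ⊕ Fin (N + 1) where
  toFun := side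
  invFun := Sum.elim leftPos rightPos
  left_inv p := by
    cases p using Fin.addCases with
    | left p => cases p using Fin.addCases <;> simp [side, leftPos, rightPos]
    | right p => fin_cases p <;> simp [side, leftPos, rightPos]
  right_inv x := by
    rcases x with i | j
    · cases i using Fin.lastCases <;> simp [side, leftPos]
    · cases j using Fin.lastCases <;> simp [side, rightPos]

theorem side_leftPos (i : Fin (M + 1)) : side (N := N) (leftPos i) = Sum.inl i :=
  sideEquiv.apply_symm_apply (Sum.inl i)

theorem side_rightPos (j : Fin (N + 1)) : side (M := M) (rightPos j) = Sum.inr j :=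
  sideEquiv.apply_symm_apply (Sum.inr j)

theorem leftPos_injective : Function.Injective (leftPos (M := M) (N := N)) :=
  sideEquiv.symm.injective.comp Sum.inl_injective

theorem rightPos_injective : Function.Injective (rightPos (M := M) (N := N)) :=
  sideEquiv.symm.injective.comp Sum.inr_injective

theorem leftPos_ne_rightPos (i : Fin (M + 1)) (j : Fin (N + 1)) : leftPos i ≠ rightPos j :=
  sideEquiv.symm.injective.ne Sum.inl_ne_inr

theorem sum_positions (c : Fin (M + N + 2) → ℤ) :
    ∑ p, c p = ∑ i, c (leftPos i) + ∑ j, c (rightPos j) :=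
  (sideEquiv.symm.sum_comp c).symm.trans (Fintype.sum_sum_type _)

theorem sum_Iio_leftPos (c : Fin (M + N + 2) → ℤ) (i : Fin (M + 1)) :
    ∑ p ∈ Finset.Iio (leftPos i), c p = ∑ i' ∈ Finset.Iio i, c (leftPos i')
      + if i = Fin.last M then ∑ j : Fin N, c (rightPos j.castSucc) else 0 := by
  have hIio {k : ℕ} (a : Fin k) : Finset.Iio a = Finset.univ.filter (· < a) := by ext; simp
  simp only [hIio, Finset.sum_filter, sum_positions, leftPos_lt_leftPos, rightPos_lt_leftPos]
  split_ifs with hi <;> simp [hi, Fin.sum_univ_castSucc, Fin.castSucc_ne_last]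

theorem sum_Iio_rightPos (c : Fin (M + N + 2) → ℤ) (j : Fin (N + 1)) :
    ∑ p ∈ Finset.Iio (rightPos j), c p = (∑ i : Fin M, c (leftPos i.castSucc)
      + if j = Fin.last N then c (leftPos (Fin.last M)) else 0)
      + ∑ j' ∈ Finset.Iio j, c (rightPos j') := by
  have hIio {k : ℕ} (a : Fin k) : Finset.Iio a = Finset.univ.filter (· < a) := by ext; simp
  simp only [hIio, Finset.sum_filter, sum_positions, rightPos_lt_rightPos, leftPos_lt_rightPos]
  split_ifs with hj <;> simp [hj, Fin.sum_univ_castSucc, Fin.castSucc_ne_last]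

end TensorPositions

section Tensor

variable {M N : ℕ}

/-- The Koszul sign in `tensor`, for moving `F_a` past `F_{M+1} ⊗ ⋯ ⊗ F_{M+N}`. -/
def tensorSign (T : States (M + N + 2)) : ℤˣ :=
  Int.negOnePow ((T (leftPos (Fin.last M))).charge * ∑ j : Fin N, (T (rightPos j.castSucc)).charge)

theorem sgn_leftPos (T : States (M + N + 2)) (i : Fin (M + 1)) (r : ℤ) :
    sgn T (leftPos i) r = (if i = Fin.last M then
      Int.negOnePow (∑ j : Fin N, (T (rightPos j.castSucc)).charge) else 1)
        * sgn (T ∘ leftPos) i r := by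
  simp only [sgn, sum_Iio_leftPos, Int.negOnePow_add, Function.comp_apply]
  split_ifs
  · rw [mul_assoc, mul_left_comm]
  · simp

theorem sgn_rightPos (T : States (M + N + 2)) (j : Fin (N + 1)) (r : ℤ) :
    sgn T (rightPos j) r = Int.negOnePow (∑ i : Fin M, (T (leftPos i.castSucc)).charge)
      * (if j = Fin.last N then Int.negOnePow (T (leftPos (Fin.last M))).charge else 1)
        * sgn (T ∘ rightPos) j r := by
  simp only [sgn, sum_Iio_rightPos, Int.negOnePow_add, Function.comp_apply]
  split_ifs <;> simp only [mul_assoc, Int.negOnePow_zero]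

open Classical in
theorem charge_toggle {L : ℕ} (T : States L) (i j : Fin L) (r : ℤ) :
    (toggle T i r j).charge
      = (T j).charge + if i = j then if r ∈ T i then -1 else 1 else 0 := by
  by_cases h : r ∈ T i
  · have hadd := charge_add (notMem_remove_self T i r) j
    rw [add_remove T i r h] at hadd
    rw [toggle_of_mem h, hadd]
    split_ifs <;> simp
  · rw [toggle_of_notMem h, charge_add h]
    simp only [h, if_false]

theorem negOnePow_charge_toggle_mul {L : ℕ} (T : States L) (i : Fin L) (r s : ℤ) :
    Int.negOnePow ((toggle T i r i).charge * s)
      = Int.negOnePow s * Int.negOnePow ((T i).charge * s) := by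
  rw [charge_toggle, if_pos rfl, add_mul, Int.negOnePow_add, mul_comm]
  split_ifs <;> simp

theorem tensorSign_toggle_leftPos (T : States (M + N + 2)) (i : Fin (M + 1)) (r : ℤ) :
    tensorSign (toggle T (leftPos i) r) = (if i = Fin.last M then
      Int.negOnePow (∑ j : Fin N, (T (rightPos j.castSucc)).charge) else 1) * tensorSign T := by
  have hright (j : Fin N) : (toggle T (leftPos i) r (rightPos j.castSucc)).charge
      = (T (rightPos j.castSucc)).charge := by
    rw [charge_toggle, if_neg (leftPos_ne_rightPos _ _), add_zero]
  simp only [tensorSign, hright]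
  split_ifs with hi
  · rw [hi, negOnePow_charge_toggle_mul]
  · rw [charge_toggle, if_neg (leftPos_injective.ne hi), add_zero, one_mul]

theorem tensorSign_toggle_rightPos (T : States (M + N + 2)) (j : Fin (N + 1)) (r : ℤ) :
    tensorSign (toggle T (rightPos j) r) = (if j = Fin.last N then 1 else
      Int.negOnePow (T (leftPos (Fin.last M))).charge) * tensorSign T := by
  have hleft : (toggle T (rightPos j) r (leftPos (Fin.last M))).charge
      = (T (leftPos (Fin.last M))).charge := by
    rw [charge_toggle, if_neg (leftPos_ne_rightPos _ _).symm, add_zero]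
  simp only [tensorSign, hleft, charge_toggle, rightPos_injective.eq_iff, Finset.sum_add_distrib]
  cases j using Fin.lastCases with
  | last => simp [(Fin.castSucc_ne_last _).symm]
  | cast j =>
    simp only [Fin.castSucc_inj, Finset.sum_ite_eq, Finset.mem_univ, if_true,
      Fin.castSucc_ne_last, if_false]
    split_ifs <;> simp [mul_add, Int.negOnePow_add, mul_comm]

theorem toggle_comp_of_injective {K L : ℕ} {g : Fin K → Fin L} (hg : Function.Injective g)
    (T : States L) (i : Fin K) (r : ℤ) : toggle T (g i) r ∘ g = toggle (T ∘ g) i r :=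
  states_ext fun j s => by simp [mem_toggle, hg.eq_iff]

theorem toggle_comp_of_forall_ne {K L : ℕ} {g : Fin K → Fin L} {p : Fin L} (hp : ∀ j, p ≠ g j)
    (T : States L) (r : ℤ) : toggle T p r ∘ g = T ∘ g :=
  states_ext fun j s => by simp [mem_toggle, hp j]

theorem hasSum_map_psiStar {K L : ℕ} {S : Type*} [CommRing S] [TopologicalSpace S]
    {Φ : Fock K S →ₗ[S] Fock L S} (hΦ : Continuous Φ) {g : Fin K → Fin L}
    (hg : Function.Injective g) {W : Fock K S}
    (hpsiStar : ∀ i r, Φ (psiStar i r W) = psiStar (g i) r (Φ W))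
    {A : Coeffs K S} (hW : ParticleRelations A W) {B : Coeffs L S}
    (hB : ∀ i j, B (g i) (g j) = A i j) (hB_zero : ∀ i, ∀ p ∉ Set.range g, B (g i) p = 0)
    (i : Fin K) (m : ℕ) :
    HasSum (fun x : Fin L × ℕ => B (g i) x.1 m x.2 • psiStar x.1 (-(x.2 : ℤ) - 1) (Φ W))
      (psiStar (g i) (m : ℤ) (Φ W)) := by
  have hinj : Function.Injective (Prod.map g (id : ℕ → ℕ)) := hg.prodMap Function.injective_id
  rw [← hinj.hasSum_iff]
  · have hsum := (hW i m).map Φ hΦ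
    simp only [Function.comp_def, map_smul, hpsiStar] at hsum
    simpa only [Function.comp_def, Prod.map, hB, id] using hsum
  · rintro ⟨p, n⟩ hp
    have hp' : p ∉ Set.range g := fun ⟨j, hj⟩ => hp ⟨(j, n), by rw [Prod.map, hj, id]⟩
    rw [hB_zero i p hp', Pi.zero_apply, Pi.zero_apply, zero_smul]

variable {R : Type*} [CommRing R]

theorem tensor_apply (V₁ : Fock (M + 1) (GlueRing R)) (V₂ : Fock (N + 1) (GlueRing R))
    (T : States (M + N + 2)) : tensor V₁ V₂ T
      = ((tensorSign T : ℤ) : GlueRing R) * (V₁ (T ∘ leftPos) * V₂ (T ∘ rightPos)) := by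
  simp only [tensor, tensorSign, leftPos, rightPos, Fin.comp_snoc, Fin.snoc_last,
    Fin.snoc_castSucc]
  rfl

open Classical in
theorem tensor_fermion_left (b : Bool) (i : Fin (M + 1)) (r : ℤ) (V₁ : Fock (M + 1) (GlueRing R))
    (V₂ : Fock (N + 1) (GlueRing R)) :
    tensor (fermion b i r V₁) V₂ = fermion b (leftPos i) r (tensor V₁ V₂) := by
  ext1 T
  have hsign : tensorSign T * sgn (T ∘ leftPos) i r
      = sgn T (leftPos i) r * tensorSign (toggle T (leftPos i) r) := by
    rw [sgn_leftPos, tensorSign_toggle_leftPos]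
    split_ifs
    · rw [mul_mul_mul_comm, Int.units_mul_self, one_mul, mul_comm]
    · rw [one_mul, one_mul, mul_comm]
  have hsign' := congrArg (fun u : ℤˣ => ((u : ℤ) : GlueRing R)) hsign
  push_cast at hsign'
  rw [fermion_apply, tensor_apply, tensor_apply, fermion_apply,
    toggle_comp_of_injective leftPos_injective,
    toggle_comp_of_forall_ne (leftPos_ne_rightPos i)]
  change _ * ((if r ∈ T (leftPos i) ↔ b = true then _ else 0) * _) = _
  split_ifs
  · rw [mul_assoc, ← mul_assoc, hsign', mul_assoc]
  · rw [zero_mul, mul_zero]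

open Classical in
theorem tensor_fermion_right (b : Bool) (j : Fin (N + 1)) (r : ℤ)
    {V₁ : Fock (M + 1) (GlueRing R)} (hV₁ : IsNeutral V₁) (V₂ : Fock (N + 1) (GlueRing R)) :
    tensor V₁ (fermion b j r V₂) = fermion b (rightPos j) r (tensor V₁ V₂) := by
  ext1 T
  rw [fermion_apply, tensor_apply, tensor_apply, fermion_apply,
    toggle_comp_of_injective rightPos_injective,
    toggle_comp_of_forall_ne fun i => (leftPos_ne_rightPos i j).symm]
  obtain hzero | hne := eq_or_ne (V₁ (T ∘ leftPos)) 0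
  · simp [hzero]
  have hsign : tensorSign T * sgn (T ∘ rightPos) j r
      = sgn T (rightPos j) r * tensorSign (toggle T (rightPos j) r) := by
    have hcharge := hV₁ _ hne
    simp only [Fin.sum_univ_castSucc, Function.comp_apply] at hcharge
    rw [sgn_rightPos, tensorSign_toggle_rightPos, eq_neg_of_add_eq_zero_left hcharge]
    split_ifs <;> simp [mul_comm, mul_left_comm, Int.units_mul_self]
  have hsign' := congrArg (fun u : ℤˣ => ((u : ℤ) : GlueRing R)) hsign
  push_cast at hsign'
  change _ * (_ * if r ∈ T (rightPos j) ↔ b = true then _ else 0) = _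
  split_ifs
  · rw [mul_left_comm (V₁ _), ← mul_assoc, hsign', mul_assoc]
  · rw [mul_zero, mul_zero]

theorem isNeutral_tensor {V₁ : Fock (M + 1) (GlueRing R)} {V₂ : Fock (N + 1) (GlueRing R)}
    (hV₁ : IsNeutral V₁) (hV₂ : IsNeutral V₂) : IsNeutral (tensor V₁ V₂) := fun T hT => by
  rw [tensor_apply] at hT
  have hleft := hV₁ _ (left_ne_zero_of_mul (right_ne_zero_of_mul hT))
  have hright := hV₂ _ (right_ne_zero_of_mul (right_ne_zero_of_mul hT))
  rw [sum_positions]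
  exact (congrArg₂ (· + ·) hleft hright).trans (add_zero 0)

/-- `tensor` as a bilinear map. -/
def tensorₗ : Fock (M + 1) (GlueRing R) →ₗ[GlueRing R] Fock (N + 1) (GlueRing R) →ₗ[GlueRing R]
    Fock (M + N + 2) (GlueRing R) :=
  LinearMap.mk₂ _ tensor
    (fun V V' W => funext fun T => by simp only [tensor_apply, Pi.add_apply]; ring)
    (fun c V W => funext fun T => by simp only [tensor_apply, Pi.smul_apply, smul_eq_mul]; ring)
    (fun V W W' => funext fun T => by simp only [tensor_apply, Pi.add_apply]; ring)
    (fun c V W => funext fun T => by simp only [tensor_apply, Pi.smul_apply, smul_eq_mul]; ring)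

theorem blockCoeffs_leftPos_leftPos (A₁ : Coeffs (M + 1) (GlueRing R))
    (A₂ : Coeffs (N + 1) (GlueRing R)) (i j : Fin (M + 1)) :
    blockCoeffs A₁ A₂ (leftPos i) (leftPos j) = A₁ i j := by
  simp only [blockCoeffs, side_leftPos]

theorem blockCoeffs_leftPos_rightPos (A₁ : Coeffs (M + 1) (GlueRing R))
    (A₂ : Coeffs (N + 1) (GlueRing R)) (i : Fin (M + 1)) (j : Fin (N + 1)) :
    blockCoeffs A₁ A₂ (leftPos i) (rightPos j) = 0 := by
  simp only [blockCoeffs, side_leftPos, side_rightPos]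
  rfl

theorem blockCoeffs_rightPos_leftPos (A₁ : Coeffs (M + 1) (GlueRing R))
    (A₂ : Coeffs (N + 1) (GlueRing R)) (i : Fin (N + 1)) (j : Fin (M + 1)) :
    blockCoeffs A₁ A₂ (rightPos i) (leftPos j) = 0 := by
  simp only [blockCoeffs, side_leftPos, side_rightPos]
  rfl

theorem blockCoeffs_rightPos_rightPos (A₁ : Coeffs (M + 1) (GlueRing R))
    (A₂ : Coeffs (N + 1) (GlueRing R)) (i j : Fin (N + 1)) :
    blockCoeffs A₁ A₂ (rightPos i) (rightPos j) = A₂ i j := by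
  simp only [blockCoeffs, side_rightPos]

section Topology

variable [TopologicalSpace (GlueRing R)] [IsTopologicalRing (GlueRing R)]

theorem continuous_tensor_left (V₂ : Fock (N + 1) (GlueRing R)) :
    Continuous fun V₁ : Fock (M + 1) (GlueRing R) => tensor V₁ V₂ := by
  refine continuous_pi fun T => ?_
  simp only [tensor_apply]
  exact continuous_const.mul ((continuous_apply _).mul continuous_const)

theorem continuous_tensor_right (V₁ : Fock (M + 1) (GlueRing R)) :
    Continuous fun V₂ : Fock (N + 1) (GlueRing R) => tensor V₁ V₂ := by
  refine continuous_pi fun T => ?_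
  simp only [tensor_apply]
  exact continuous_const.mul (continuous_const.mul (continuous_apply _))

theorem particleRelations_tensor {A₁ : Coeffs (M + 1) (GlueRing R)}
    {A₂ : Coeffs (N + 1) (GlueRing R)} {V₁ : Fock (M + 1) (GlueRing R)}
    {V₂ : Fock (N + 1) (GlueRing R)} (h₁ : ParticleRelations A₁ V₁) (hV₁ : IsNeutral V₁)
    (h₂ : ParticleRelations A₂ V₂) :
    ParticleRelations (blockCoeffs A₁ A₂) (tensor V₁ V₂) := fun p m => by
  obtain ⟨i | j, rfl⟩ := sideEquiv.symm.surjective p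
  · refine hasSum_map_psiStar (Φ := tensorₗ.flip V₂) (continuous_tensor_left V₂) leftPos_injective
      (fun i r => tensor_fermion_left false i r V₁ V₂) h₁ (blockCoeffs_leftPos_leftPos A₁ A₂)
      (fun i p hp => ?_) i m
    obtain ⟨i' | j', rfl⟩ := sideEquiv.symm.surjective p
    · exact absurd ⟨i', rfl⟩ hp
    · exact blockCoeffs_leftPos_rightPos A₁ A₂ i j'
  · refine hasSum_map_psiStar (Φ := tensorₗ V₁) (continuous_tensor_right V₁) rightPos_injective
      (fun j r => tensor_fermion_right false j r hV₁ V₂) h₂ (blockCoeffs_rightPos_rightPos A₁ A₂)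
      (fun i p hp => ?_) j m
    obtain ⟨i' | j', rfl⟩ := sideEquiv.symm.surjective p
    · exact blockCoeffs_rightPos_leftPos A₁ A₂ i i'
    · exact absurd ⟨j', rfl⟩ hp

end Topology

theorem tensor_bogoliubov [Algebra ℂ R] (A₁ : Coeffs (M + 1) (GlueRing R))
    (A₂ : Coeffs (N + 1) (GlueRing R)) :
    tensor (bogoliubov A₁) (bogoliubov A₂) = bogoliubov (blockCoeffs A₁ A₂) := by
  let : TopologicalSpace (GlueRing R) := ⊥
  have : DiscreteTopology (GlueRing R) := ⟨rfl⟩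
  have hrelations := particleRelations_tensor (particleRelations_bogoliubov A₁)
    (isNeutral_bogoliubov A₁) (particleRelations_bogoliubov A₂)
  have hneutral := isNeutral_tensor (isNeutral_bogoliubov A₁) (isNeutral_bogoliubov A₂)
  have hvacuum : tensor (bogoliubov A₁) (bogoliubov A₂) (fun _ => Maya.vacuum) = 1 := by
    have h (L : ℕ) (A : Coeffs (L + 1) (GlueRing R)) (g : Fin (L + 1) → Fin (M + N + 2)) :
        bogoliubov A ((fun _ => Maya.vacuum) ∘ g) = 1 := bogoliubov_vacuum A
    simp [tensor_apply, h, tensorSign, Maya.charge_vacuum]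
  rw [hrelations.eq_smul_bogoliubov hneutral, hvacuum, one_smul]

end Tensor

/-! ### Divisibility of Bogoliubov transforms -/

section Decay

variable {N : ℕ} {S : Type*} [CommRing S]

theorem dvd_of_hasSum [TopologicalSpace S] {d : S} (hd : IsClosed {z | d ∣ z}) {ι : Type*}
    {g : ι → S} {z : S} (hg : HasSum g z) (h : ∀ i, d ∣ g i) : d ∣ z :=
  hd.mem_of_tendsto hg (.of_forall fun _ => Finset.dvd_sum fun i _ => h i)

variable [Algebra ℂ S]

theorem dvd_bogoliubov_of_particle {A : Coeffs N S} {d : S} {i : Fin N} {m : ℕ}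
    (h : ∀ j n, d ∣ A i j m n) {T : States N} (hm : (m : ℤ) ∈ T i) : d ∣ bogoliubov A T := by
  let : TopologicalSpace S := ⊥
  have : DiscreteTopology S := ⟨rfl⟩
  have hsum := Pi.hasSum.1 (hasSum_psiStar_bogoliubov A i m) (toggle T i m)
  have hdvd := dvd_of_hasSum (isClosed_discrete _) hsum fun x => (h x.1 x.2).mul_right _
  exact (hdvd.mul_left _).trans
    (apply_eq_sgn_mul_fermion (b := false) (by simpa using hm) (bogoliubov A)).symm.dvd

theorem dvd_bogoliubov_of_hole {A : Coeffs N S} {d : S} {j : Fin N} {n : ℕ}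
    (h : ∀ i m, d ∣ A i j m n) {T : States N} (hn : -(n : ℤ) - 1 ∉ T j) :
    d ∣ bogoliubov A T := by
  let : TopologicalSpace S := ⊥
  have : DiscreteTopology S := ⟨rfl⟩
  have hsum := Pi.hasSum.1 (hasSum_psi_bogoliubov A j n) (toggle T j (-(n : ℤ) - 1))
  have hdvd := dvd_of_hasSum (isClosed_discrete _) hsum fun x =>
    (h x.1 x.2).neg_right.mul_right _
  exact (hdvd.mul_left _).trans
    (apply_eq_sgn_mul_fermion (b := true) (by simpa using hn) (bogoliubov A)).symm.dvd

theorem finite_states (N k : ℕ) :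
    {T : States N | ∀ i (m : ℕ), k ≤ m → (m : ℤ) ∉ T i ∧ -(m : ℤ) - 1 ∈ T i}.Finite := by
  refine Set.Finite.of_injOn (f := fun T i => (T i).carrier ∩ Set.Ico (-(k : ℤ)) k)
    (t := Set.univ.pi fun _ => 𝒫 (Set.Ico (-(k : ℤ)) k)) (fun T _ i _ => Set.inter_subset_right) ?_
    (Set.Finite.pi fun _ => (Set.finite_Ico _ _).powerset)
  refine fun T hT U hU h => states_ext fun i r => ?_
  have hwindow := Set.ext_iff.1 (congrFun h i) r
  by_cases hr : r ∈ Set.Ico (-(k : ℤ)) k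
  · exact ⟨fun hrT => (hwindow.1 ⟨hrT, hr⟩).1, fun hrU => (hwindow.2 ⟨hrU, hr⟩).1⟩
  · rw [Set.mem_Ico, not_and_or, not_le, not_lt] at hr
    obtain hr | hr := hr
    · obtain ⟨m, rfl⟩ : ∃ m : ℕ, r = -(m : ℤ) - 1 := ⟨(-r - 1).toNat, by omega⟩
      exact iff_of_true (hT i m (by omega)).2 (hU i m (by omega)).2
    · lift r to ℕ using by omega
      exact iff_of_false (hT i r (by omega)).1 (hU i r (by omega)).1

end Decay

section GlueVector

variable {R : Type*} [CommRing R] [Algebra ℂ R] (q : Rˣ) (f : ℤ)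

theorem glueCoeffs_eq_zero {i j : Fin 2} {m n : ℕ} (h : (i, m) ≠ (j.rev, n)) :
    glueCoeffs q f i j m n = 0 := by
  by_cases hmn : m = n
  · subst hmn
    fin_cases i <;> fin_cases j <;> first | rfl | simp [glueCoeffs] at h ⊢
  · exact if_neg hmn

theorem X_pow_dvd_glueCoeffs {i j : Fin 2} {m n k : ℕ} (h : k ≤ m ∨ k ≤ n) :
    (PowerSeries.X : GlueRing R) ^ (k + 1) ∣ glueCoeffs q f i j m n := by
  by_cases hmn : m = n
  · have hX : (PowerSeries.X : GlueRing R) ^ (k + 1) ∣ PowerSeries.X ^ (2 * n + 1) :=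
      pow_dvd_pow _ (by omega)
    unfold glueCoeffs
    split_ifs
    exacts [hX.mul_right _, hX.mul_right _, dvd_zero _]
  · rw [glueCoeffs_eq_zero q f (by simp [hmn])]
    exact dvd_zero _

theorem X_pow_dvd_glueVector_of_particle {T : States 2} {i : Fin 2} {m : ℕ}
    (h : (m : ℤ) ∈ T i) : (PowerSeries.X : GlueRing R) ^ (m + 1) ∣ glueVector q f T :=
  dvd_bogoliubov_of_particle (fun _ _ => X_pow_dvd_glueCoeffs q f (.inl le_rfl)) h

theorem X_pow_dvd_glueVector_of_hole {T : States 2} {j : Fin 2} {n : ℕ}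
    (h : -(n : ℤ) - 1 ∉ T j) : (PowerSeries.X : GlueRing R) ^ (n + 1) ∣ glueVector q f T :=
  dvd_bogoliubov_of_hole (fun _ _ => X_pow_dvd_glueCoeffs q f (.inr le_rfl)) h

theorem X_dvd_glueVector_of_ne {T : States 2} (h : T ≠ fun _ => Maya.vacuum) :
    (PowerSeries.X : GlueRing R) ∣ glueVector q f T := by
  by_cases hparticles : particles T = 0
  · have hcharge : ∑ i, (T i).charge ≠ 0 := mt (eq_vacuum_of_neutral hparticles) h
    rw [glueVector, not_imp_comm.1 (isNeutral_bogoliubov _ T) hcharge]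
    exact dvd_zero _
  · obtain ⟨i, m, hm⟩ := exists_mem_of_particles_ne_zero hparticles
    exact (dvd_pow_self _ m.succ_ne_zero).trans (X_pow_dvd_glueVector_of_particle q f hm)

theorem psi_glueVector (c : Fin 2) (n : ℕ) :
    psi c (-(n : ℤ) - 1) (glueVector q f)
      = -glueCoeffs q f c.rev c n n • psi c.rev (n : ℤ) (glueVector q f) := by
  let : TopologicalSpace (GlueRing R) := ⊥
  have : DiscreteTopology (GlueRing R) := ⟨rfl⟩
  have hsum := hasSum_psi_bogoliubov (glueCoeffs q f) c n
  refine hsum.unique (hasSum_single (c.rev, n) fun x hx => ?_)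
  rw [glueCoeffs_eq_zero q f hx, neg_zero, zero_smul]

end GlueVector

/-! ### The pairing -/

section Pairing

/-- A family of power series tending to zero `X`-adically. -/
def AdicallyNull {B : Type*} [CommRing B] {ι : Type*} (P : ι → B⟦X⟧) : Prop :=
  ∀ k, {i | ¬ PowerSeries.X ^ k ∣ P i}.Finite

theorem adicallyNull_glueVector {R : Type*} [CommRing R] [Algebra ℂ R] (q : Rˣ) (f : ℤ) :
    AdicallyNull (glueVector q f) := fun k => by
  refine (finite_states 2 k).subset fun T hT i m hm => ⟨fun hmem => hT ?_, ?_⟩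
  · exact (pow_dvd_pow _ (by omega)).trans (X_pow_dvd_glueVector_of_particle q f hmem)
  · by_contra hnotMem
    exact hT ((pow_dvd_pow _ (by omega)).trans (X_pow_dvd_glueVector_of_hole q f hnotMem))

theorem coeff_mul_of_X_pow_dvd {B : Type*} [CommRing B] {a b : B⟦X⟧} {k : ℕ}
    (h : PowerSeries.X ^ (k + 1) ∣ b) : PowerSeries.coeff k (a * b) = 0 :=
  PowerSeries.X_pow_dvd_iff.1 (h.mul_left a) k k.lt_succ_self

variable {R : Type*} [CommRing R] {P : Fock 2 (GlueRing R)}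

theorem AdicallyNull.pairingConverges (hP : AdicallyNull P) (U : Fock 2 (GlueRing R)) :
    PairingConverges U P := fun k =>
  (hP (k + 1)).subset fun _ hT hdvd => hT (coeff_mul_of_X_pow_dvd hdvd)

theorem AdicallyNull.coeff_pairing (hP : AdicallyNull P) (U : Fock 2 (GlueRing R)) (k : ℕ) :
    PowerSeries.coeff k (pairing U P)
      = ∑ T ∈ (hP (k + 1)).toFinset, PowerSeries.coeff k (U T * P T) := by
  rw [pairing, PowerSeries.coeff_mk]
  refine finsum_eq_sum_of_support_subset _ fun T hT => ?_
  rw [Finset.mem_coe, Set.Finite.mem_toFinset]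
  exact fun hdvd => hT (coeff_mul_of_X_pow_dvd hdvd)

theorem pairing_smul_right (c : GlueRing R) (U P : Fock 2 (GlueRing R)) :
    pairing U (c • P) = pairing (c • U) P := by
  simp only [pairing, Pi.smul_apply, smul_eq_mul, mul_left_comm, mul_assoc]

theorem pairing_fermion (b : Bool) (c : Fin 2) (r : ℤ) (U P : Fock 2 (GlueRing R)) :
    pairing (fermion b c r U) P = pairing U (fermion (!b) c r P) := by
  have hinvolutive : Function.Involutive fun T : States 2 => toggle T c r := fun T =>
    toggle_toggle T c r
  have hterm (T) : fermion b c r U (toggle T c r) * P (toggle T c r)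
      = U T * fermion (!b) c r P T := by
    rw [fermion_apply, fermion_apply, toggle_toggle, sgn_toggle_self]
    cases b <;> by_cases h : r ∈ T c <;> simp [mem_toggle, h, mul_left_comm, mul_assoc]
  refine PowerSeries.ext fun k => ?_
  simp only [pairing, PowerSeries.coeff_mk, ← hterm]
  exact (finsum_comp_equiv hinvolutive.toPerm
    (f := fun T => PowerSeries.coeff k (fermion b c r U T * P T))).symm

open scoped PowerSeries.WithPiTopology

theorem AdicallyNull.hasSum_pairing [TopologicalSpace R[T;T⁻¹]] (hP : AdicallyNull P)
    (U : Fock 2 (GlueRing R)) : HasSum (fun T => U T * P T) (pairing U P) := by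
  refine (PowerSeries.WithPiTopology.hasSum_iff_hasSum_coeff ..).2 fun k => ?_
  rw [hP.coeff_pairing]
  exact hasSum_sum_of_ne_finset_zero fun T hT => coeff_mul_of_X_pow_dvd (by simpa using hT)

theorem AdicallyNull.pairing_add (hP : AdicallyNull P) (U V : Fock 2 (GlueRing R)) :
    pairing (U + V) P = pairing U P + pairing V P := by
  ext k
  simp only [map_add, hP.coeff_pairing, Pi.add_apply, add_mul, Finset.sum_add_distrib]

theorem AdicallyNull.pairing_smul (hP : AdicallyNull P) (c : GlueRing R)
    (U : Fock 2 (GlueRing R)) : pairing (c • U) P = c * pairing U P := by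
  let : TopologicalSpace R[T;T⁻¹] := ⊥
  have : DiscreteTopology R[T;T⁻¹] := ⟨rfl⟩
  have hsum := (hP.hasSum_pairing U).mul_left c
  simp only [← mul_assoc] at hsum
  exact (hP.hasSum_pairing (c • U)).unique hsum

theorem AdicallyNull.continuous_pairing [TopologicalSpace R[T;T⁻¹]]
    [IsTopologicalRing R[T;T⁻¹]] (hP : AdicallyNull P) :
    Continuous fun U : Fock 2 (GlueRing R) => pairing U P := by
  refine continuous_iff_continuousAt.2 fun U =>
    (PowerSeries.WithPiTopology.tendsto_iff_coeff_tendsto ..).2 fun k => ?_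
  simp only [hP.coeff_pairing]
  refine tendsto_finsetSum _ fun T _ => ?_
  exact ((PowerSeries.WithPiTopology.continuous_coeff _ k).comp
    ((continuous_apply T).mul continuous_const)).tendsto U

end Pairing

/-! ### Particle relations under contractions -/

section HoleProjection

variable {M : ℕ} {S : Type*} [CommRing S]

theorem psiStar_apply_of_mem {i : Fin M} {r : ℤ} {T : States M} (h : r ∈ T i) (V : Fock M S) :
    psiStar i r V T = 0 := if_pos h

theorem hole_mem_vacuum (n : ℕ) : -(n : ℤ) - 1 ∈ Maya.vacuum := by
  change -(n : ℤ) - 1 < 0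
  omega

open Classical in
theorem psi_psiStar_apply_vacuum (W : Fock M S) (i j : Fin M) (m n : ℕ) :
    psi i (-(m : ℤ) - 1) (psiStar j (-(n : ℤ) - 1) W) (fun _ => Maya.vacuum)
      = if i = j ∧ m = n then W fun _ => Maya.vacuum else 0 := by
  rw [psi_psiStar, Pi.add_apply, Pi.neg_apply, psiStar_apply_of_mem (hole_mem_vacuum n), neg_zero,
    zero_add]
  by_cases h : i = j ∧ m = n <;> simp [h]

/-- The sum `∑_{i,n} ⟨0|ψ^i_{-(n+1/2)} Z⟩ ψ^{i*}_{-(n+1/2)} W`. If `W` has vacuum coefficient one,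
this is the projection onto the combinations of the vectors `ψ^{i*}_{-(n+1/2)} W`. -/
def holeProjection (W : Fock M S) : Fock M S →ₗ[S] Fock M S where
  toFun Z := fun T => ∑ x ∈ (finite_holes T).toFinset,
    psi x.1 (-(x.2 : ℤ) - 1) Z (fun _ => Maya.vacuum) * psiStar x.1 (-(x.2 : ℤ) - 1) W T
  map_add' Y Z := funext fun T => by
    simp only [map_add, Pi.add_apply, add_mul, Finset.sum_add_distrib]
  map_smul' c Z := funext fun T => by
    simp only [map_smul, Pi.smul_apply, smul_eq_mul, mul_assoc, Finset.mul_sum, RingHom.id_apply]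

variable [TopologicalSpace S]

theorem hasSum_holeProjection (W Z : Fock M S) :
    HasSum (fun x : Fin M × ℕ => psi x.1 (-(x.2 : ℤ) - 1) Z (fun _ => Maya.vacuum) •
      psiStar x.1 (-(x.2 : ℤ) - 1) W) (holeProjection W Z) :=
  Pi.hasSum.2 fun T => hasSum_sum_of_ne_finset_zero fun x hx => by
    rw [Set.Finite.mem_toFinset, Set.mem_ofPred_eq, not_not] at hx
    rw [Pi.smul_apply, psiStar_apply_of_mem hx, smul_zero]

theorem holeProjection_psiStar [T2Space S] {W : Fock M S} (hW : W (fun _ => Maya.vacuum) = 1)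
    (j : Fin M) (n : ℕ) :
    holeProjection W (psiStar j (-(n : ℤ) - 1) W) = psiStar j (-(n : ℤ) - 1) W := by
  have hsum := hasSum_holeProjection W (psiStar j (-(n : ℤ) - 1) W)
  simp only [psi_psiStar_apply_vacuum, hW] at hsum
  refine hsum.unique ?_
  convert hasSum_single (j, n) fun x hx => ?_ using 1
  · simp
  · rw [if_neg fun h => hx (Prod.ext h.1 h.2), zero_smul]

-- The relations of `V` let `E` be computed on particles from its values on holes, hence from
-- `d` times its values on particles.
theorem ParticleRelations.map_psiStar_eq_zero {N : ℕ} {d : S}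
    (hclosed : ∀ k, IsClosed {z | d ^ k ∣ z}) (hseparated : ∀ z, (∀ k, d ^ k ∣ z) → z = 0)
    {A : Coeffs N S} {V : Fock N S} (hV : ParticleRelations A V)
    {E : Fock N S →ₗ[S] Fock M S} (hE : Continuous E)
    (hhole : ∀ (j : Fin N) (n : ℕ), E (psiStar j (-(n : ℤ) - 1) V) = 0 ∨
      ∃ i, ∃ m : ℕ, ∃ a, d ∣ a ∧ E (psiStar j (-(n : ℤ) - 1) V) = a • E (psiStar i (m : ℤ) V))
    (i : Fin N) (m : ℕ) : E (psiStar i (m : ℤ) V) = 0 := by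
  suffices hdvd : ∀ k i (m : ℕ) T, d ^ k ∣ E (psiStar i (m : ℤ) V) T from
    funext fun T => hseparated _ fun k => hdvd k i m T
  intro k
  induction k with
  | zero => simp
  | succ k ih =>
    intro i m T
    refine dvd_of_hasSum (hclosed _) (Pi.hasSum.1 ((hV i m).map E hE) T) fun x => ?_
    simp only [Function.comp_apply, map_smul, Pi.smul_apply, smul_eq_mul]
    refine Dvd.dvd.mul_left ?_ _
    obtain hzero | ⟨i', m', a, hda, ha⟩ := hhole x.1 x.2
    · rw [hzero]
      exact dvd_zero _
    · rw [ha, pow_succ']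
      exact mul_dvd_mul hda (ih i' m' T)

variable [IsTopologicalRing S]

theorem continuous_holeProjection (W : Fock M S) : Continuous (holeProjection W) :=
  continuous_pi fun _ => continuous_finsetSum _ fun x _ =>
    ((continuous_apply fun _ => Maya.vacuum).comp (continuous_psi x.1 _)).mul continuous_const

theorem ParticleRelations.exists_map {K : ℕ} [T2Space S] {d : S}
    (hclosed : ∀ k, IsClosed {z | d ^ k ∣ z}) (hseparated : ∀ z, (∀ k, d ^ k ∣ z) → z = 0)
    {A : Coeffs (M + K) S} {V : Fock (M + K) S} (hV : ParticleRelations A V)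
    {L : Fock (M + K) S →ₗ[S] Fock M S} (hL : Continuous L)
    (hopen : ∀ i r, L (psiStar (Fin.castAdd K i) r V) = psiStar i r (L V))
    (hglued : ∀ (c : Fin K) (n : ℕ), ∃ i, ∃ m : ℕ, ∃ a, d ∣ a ∧
      L (psiStar (Fin.natAdd M c) (-(n : ℤ) - 1) V) = a • L (psiStar i (m : ℤ) V))
    (hvacuum : L V (fun _ => Maya.vacuum) = 1) : ∃ A', ParticleRelations A' (L V) := by
  let E : Fock (M + K) S →ₗ[S] Fock M S := L - holeProjection (L V) ∘ₗ L
  have hE : Continuous E := hL.sub ((continuous_holeProjection (L V)).comp hL)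
  have hEopen (i : Fin M) (n : ℕ) : E (psiStar (Fin.castAdd K i) (-(n : ℤ) - 1) V) = 0 := by
    simp only [E, LinearMap.sub_apply, LinearMap.comp_apply, hopen,
      holeProjection_psiStar hvacuum, sub_self]
  have hEglued (c : Fin K) (n : ℕ) : ∃ i, ∃ m : ℕ, ∃ a, d ∣ a ∧
      E (psiStar (Fin.natAdd M c) (-(n : ℤ) - 1) V) = a • E (psiStar i (m : ℤ) V) := by
    obtain ⟨i, m, a, hda, ha⟩ := hglued c n
    refine ⟨i, m, a, hda, ?_⟩
    simp only [E, LinearMap.sub_apply, LinearMap.comp_apply, ha, map_smul, smul_sub]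
  have hfixed (i : Fin M) (m : ℕ) :
      holeProjection (L V) (psiStar i (m : ℤ) (L V)) = psiStar i (m : ℤ) (L V) := by
    rw [← hopen, eq_comm, ← sub_eq_zero]
    exact hV.map_psiStar_eq_zero hclosed hseparated hE
      (Fin.addCases (fun i n => .inl (hEopen i n)) fun c n => .inr (hEglued c n)) _ m
  exact ⟨fun i j m n => psi j (-(n : ℤ) - 1) (psiStar i (m : ℤ) (L V)) fun _ => Maya.vacuum,
    fun i m => hfixed i m ▸ hasSum_holeProjection (L V) (psiStar i (m : ℤ) (L V))⟩

end HoleProjection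

/-! ### Self-gluing -/

section Append

variable {M K : ℕ}

theorem toggle_append_castAdd (T : States M) (U : States K) (i : Fin M) (r : ℤ) :
    toggle (Fin.append T U : States (M + K)) (Fin.castAdd K i) r
      = (Fin.append (toggle T i r) U : States (M + K)) :=
  states_ext fun j s => by
    refine Fin.addCases (fun j => ?_) (fun c => ?_) j
    · simp [mem_toggle]
    · simp [mem_toggle, Fin.ext_iff, (i.isLt.trans_le (Nat.le_add_right M c)).ne]

theorem toggle_append_natAdd (T : States M) (U : States K) (c : Fin K) (r : ℤ) :
    toggle (Fin.append T U : States (M + K)) (Fin.natAdd M c) r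
      = (Fin.append T (toggle U c r) : States (M + K)) :=
  states_ext fun j s => by
    refine Fin.addCases (fun j => ?_) (fun d => ?_) j
    · simp [mem_toggle, Fin.ext_iff, (j.isLt.trans_le (Nat.le_add_right M c)).ne']
    · simp [mem_toggle]

theorem sgn_append_castAdd (T : States M) (U : States K) (i : Fin M) (r : ℤ) :
    sgn (Fin.append T U : States (M + K)) (Fin.castAdd K i) r = sgn T i r := by
  unfold sgn
  rw [← Fin.map_castAddEmb_Iio, Finset.sum_map]
  simp only [Fin.append_left, Fin.coe_castAddEmb]

theorem sgn_append_natAdd (T : States M) (U : States K) (c : Fin K) (r : ℤ) :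
    sgn (Fin.append T U : States (M + K)) (Fin.natAdd M c) r
      = Int.negOnePow (∑ i, (T i).charge) * sgn U c r := by
  have hpositions : ∑ j ∈ Finset.Iio (Fin.natAdd M c),
      ((Fin.append T U : States (M + K)) j).charge
        = ∑ i, (T i).charge + ∑ d ∈ Finset.Iio c, (U d).charge := by
    have hleft (i : Fin M) : Fin.castAdd K i < Fin.natAdd M c := by
      rw [Fin.lt_def, Fin.val_castAdd, Fin.val_natAdd]; omega
    have hright (d : Fin K) : Fin.natAdd M d < Fin.natAdd M c ↔ d < c := by
      rw [Fin.lt_def, Fin.lt_def, Fin.val_natAdd, Fin.val_natAdd]; omega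
    simp only [← Finset.filter_gt_eq_Iio, Finset.sum_filter, Fin.sum_univ_add, Fin.append_left,
      Fin.append_right, hleft, hright, if_true]
  rw [sgn, sgn, hpositions, Fin.append_right, ← Int.negOnePow_add, add_assoc]

theorem append_vacuum (K : ℕ) :
    Fin.append (fun _ : Fin M => Maya.vacuum) (fun _ : Fin K => Maya.vacuum)
      = fun _ => Maya.vacuum := by
  refine funext fun j => ?_
  cases j using Fin.addCases <;> simp

end Append

section SelfGluing

variable {M : ℕ} {R : Type*} [CommRing R]

theorem slice_fermion_castAdd (b : Bool) (i : Fin M) (r : ℤ) (V : Fock (M + 2) (GlueRing R))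
    (T : States M) (U : States 2) :
    slice (fermion b (Fin.castAdd 2 i) r V) T U = fermion b i r (fun T' => slice V T' U) T := by
  by_cases h : r ∈ T i ↔ b = true <;>
    simp [slice, fermion_apply, toggle_append_castAdd, sgn_append_castAdd, h]

theorem slice_fermion_natAdd (b : Bool) (c : Fin 2) (r : ℤ) (V : Fock (M + 2) (GlueRing R))
    (T : States M) :
    slice (fermion b (Fin.natAdd M c) r V) T
      = ((Int.negOnePow (∑ i, (T i).charge) : ℤ) : GlueRing R) • fermion b c r (slice V T) := by
  funext U
  by_cases h : r ∈ U c ↔ b = true <;>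
    simp [slice, fermion_apply, toggle_append_natAdd, sgn_append_natAdd, h, mul_assoc]

theorem slice_psiStar_natAdd_vacuum (c : Fin 2) (r : ℤ) (V : Fock (M + 2) (GlueRing R)) :
    slice (psiStar (Fin.natAdd M c) r V) (fun _ => Maya.vacuum)
      = psiStar c r (slice V fun _ => Maya.vacuum) :=
  (slice_fermion_natAdd false c r V fun _ => Maya.vacuum).trans <| by
    simp [Maya.charge_vacuum, fermion]

theorem slice_psiStar_castAdd_vacuum (i : Fin M) (n : ℕ) (V : Fock (M + 2) (GlueRing R)) :
    slice (psiStar (Fin.castAdd 2 i) (-(n : ℤ) - 1) V) (fun _ => Maya.vacuum) = 0 :=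
  funext fun U => (slice_fermion_castAdd false i _ V _ U).trans
    (psiStar_apply_of_mem (hole_mem_vacuum n) _)

theorem ParticleRelations.slice_vacuum [TopologicalSpace (GlueRing R)]
    {A : Coeffs (M + 2) (GlueRing R)} {V : Fock (M + 2) (GlueRing R)}
    (hV : ParticleRelations A V) :
    ParticleRelations (restrictAB A) (slice V fun _ => Maya.vacuum) := fun c m => by
  have hinjective : Function.Injective (Prod.map (Fin.natAdd M : Fin 2 → _) (id : ℕ → ℕ)) :=
    (Fin.natAdd_injective 2 M).prodMap Function.injective_id
  have hsum : HasSum (fun x : Fin (M + 2) × ℕ => A (Fin.natAdd M c) x.1 m x.2 •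
      slice (psiStar x.1 (-(x.2 : ℤ) - 1) V) fun _ => Maya.vacuum)
      (slice (psiStar (Fin.natAdd M c) (m : ℤ) V) fun _ => Maya.vacuum) :=
    Pi.hasSum.2 fun U => Pi.hasSum.1 (hV (Fin.natAdd M c) m) (Fin.append _ U)
  rw [slice_psiStar_natAdd_vacuum, ← hinjective.hasSum_iff] at hsum
  · simpa only [Function.comp_def, Prod.map_fst, Prod.map_snd, id_eq,
      slice_psiStar_natAdd_vacuum, restrictAB] using hsum
  · rintro ⟨j, n⟩ hj
    induction j using Fin.addCases with
    | left i => rw [slice_psiStar_castAdd_vacuum, smul_zero]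
    | right d => exact absurd ⟨(d, n), rfl⟩ hj

variable [Algebra ℂ R]

theorem slice_bogoliubov_vacuum (A : Coeffs (M + 2) (GlueRing R)) :
    slice (bogoliubov A) (fun _ => Maya.vacuum) = bogoliubov (restrictAB A) := by
  let : TopologicalSpace (GlueRing R) := ⊥
  have : DiscreteTopology (GlueRing R) := ⟨rfl⟩
  have hneutral : IsNeutral (slice (bogoliubov A) fun _ => Maya.vacuum) := fun U hU => by
    simpa [Fin.sum_univ_add, Maya.charge_vacuum] using isNeutral_bogoliubov A _ hU
  rw [(particleRelations_bogoliubov A).slice_vacuum.eq_smul_bogoliubov hneutral, slice,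
    append_vacuum, bogoliubov_vacuum, one_smul]

variable (q : Rˣ) (f : ℤ)

/-- The self-gluing as a linear map. -/
def selfGluingₗ : Fock (M + 2) (GlueRing R) →ₗ[GlueRing R] Fock M (GlueRing R) where
  toFun := selfGluing q f
  map_add' V W := funext fun T =>
    (adicallyNull_glueVector q f).pairing_add (slice V T) (slice W T)
  map_smul' c V := funext fun T => (adicallyNull_glueVector q f).pairing_smul c (slice V T)

theorem selfGluing_psiStar_castAdd (i : Fin M) (r : ℤ) (V : Fock (M + 2) (GlueRing R)) :
    selfGluing q f (psiStar (Fin.castAdd 2 i) r V) = psiStar i r (selfGluing q f V) := by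
  change selfGluing q f (fermion false _ _ _) = fermion false _ _ _
  funext T
  have hP := adicallyNull_glueVector q f
  have hslice := funext (slice_fermion_castAdd false i r V T)
  rw [selfGluing, hslice, fermion_apply]
  by_cases hr : r ∈ T i ↔ false = true
  · simp only [fermion_apply, hr, if_true]
    exact hP.pairing_smul _ (slice V (toggle T i r))
  · simp only [fermion_apply, hr, if_false]
    change pairing 0 _ = 0
    simpa using hP.pairing_smul 0 0

theorem selfGluing_psiStar_natAdd_apply (c : Fin 2) (r : ℤ) (V : Fock (M + 2) (GlueRing R))
    (T : States M) :
    selfGluing q f (psiStar (Fin.natAdd M c) r V) T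
      = pairing (((Int.negOnePow (∑ i, (T i).charge) : ℤ) : GlueRing R) • slice V T)
          (psi c r (glueVector q f)) := by
  change selfGluing q f (fermion false _ _ _) T = pairing _ (fermion (!false) _ _ _)
  rw [selfGluing, slice_fermion_natAdd, ← map_smul, pairing_fermion]

theorem selfGluing_psiStar_natAdd (c : Fin 2) (n : ℕ) (V : Fock (M + 2) (GlueRing R)) :
    selfGluing q f (psiStar (Fin.natAdd M c) (-(n : ℤ) - 1) V)
      = -glueCoeffs q f c.rev c n n •
        selfGluing q f (psiStar (Fin.natAdd M c.rev) (n : ℤ) V) := by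
  set g := -glueCoeffs q f c.rev c n n
  have hlinear : g • selfGluing q f (psiStar (Fin.natAdd M c.rev) (n : ℤ) V)
      = selfGluing q f (psiStar (Fin.natAdd M c.rev) (n : ℤ) (g • V)) := by
    rw [map_smul]
    exact ((selfGluingₗ q f).map_smul g _).symm
  funext T
  rw [hlinear, selfGluing_psiStar_natAdd_apply, selfGluing_psiStar_natAdd_apply, psi_glueVector,
    pairing_smul_right, smul_comm]
  rfl

theorem isNeutral_selfGluing {V : Fock (M + 2) (GlueRing R)} (hV : IsNeutral V) :
    IsNeutral (selfGluing q f V) := fun T hT => by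
  contrapose! hT
  have hterm (U : States 2) : slice V T U * glueVector q f U = 0 := by
    by_contra hne
    have hTU := hV _ (left_ne_zero_of_mul hne)
    simp only [Fin.sum_univ_add, Fin.append_left, Fin.append_right,
      isNeutral_bogoliubov _ U (right_ne_zero_of_mul hne), add_zero] at hTU
    exact hT hTU
  refine PowerSeries.ext fun k => ?_
  simp only [selfGluing, pairing, hterm, map_zero, finsum_zero, PowerSeries.coeff_mk]

theorem selfGluing_bogoliubov_vacuum (A : Coeffs (M + 2) (GlueRing R)) :
    selfGluing q f (bogoliubov A) (fun _ => Maya.vacuum) = closedPart q f A := by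
  rw [selfGluing, slice_bogoliubov_vacuum, closedPart]

theorem constantCoeff_pairing_glueVector (U : Fock 2 (GlueRing R)) :
    PowerSeries.constantCoeff (pairing U (glueVector q f))
      = PowerSeries.constantCoeff (U fun _ => Maya.vacuum) := by
  rw [← PowerSeries.coeff_zero_eq_constantCoeff_apply,
    ← PowerSeries.coeff_zero_eq_constantCoeff_apply, pairing, PowerSeries.coeff_mk,
    finsum_eq_single _ (fun _ => Maya.vacuum), glueVector, bogoliubov_vacuum, mul_one]
  intro T hT
  refine coeff_mul_of_X_pow_dvd ?_
  simpa using X_dvd_glueVector_of_ne q f hT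

theorem isUnit_closedPart (A : Coeffs (M + 2) (GlueRing R)) : IsUnit (closedPart q f A) := by
  rw [closedPart, PowerSeries.isUnit_iff_constantCoeff, constantCoeff_pairing_glueVector,
    bogoliubov_vacuum, map_one]
  exact isUnit_one

open scoped PowerSeries.WithPiTopology

theorem continuous_selfGluingₗ [TopologicalSpace R[T;T⁻¹]] [IsTopologicalRing R[T;T⁻¹]] :
    Continuous (selfGluingₗ (M := M) q f) :=
  continuous_pi fun _ => (adicallyNull_glueVector q f).continuous_pairing.comp
    (continuous_pi fun _ => continuous_apply _)

theorem isClosed_X_pow_dvd {B : Type*} [CommRing B] [TopologicalSpace B] [T1Space B] (k : ℕ) :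
    IsClosed {z : B⟦X⟧ | PowerSeries.X ^ k ∣ z} := by
  simp only [PowerSeries.X_pow_dvd_iff, Set.ofPred_forall]
  exact isClosed_iInter fun i => isClosed_iInter fun _ =>
    isClosed_singleton.preimage (PowerSeries.WithPiTopology.continuous_coeff B i)

theorem eq_zero_of_forall_X_pow_dvd {B : Type*} [CommRing B] {z : B⟦X⟧}
    (h : ∀ k, PowerSeries.X ^ k ∣ z) : z = 0 :=
  PowerSeries.ext fun k => PowerSeries.X_pow_dvd_iff.1 (h (k + 1)) k k.lt_succ_self

theorem normalizedSelfGluing_bogoliubov_vacuum (A : Coeffs (M + 2) (GlueRing R)) :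
    normalizedSelfGluing q f (bogoliubov A) A (fun _ => Maya.vacuum) = 1 := by
  rw [normalizedSelfGluing, Pi.smul_apply, selfGluing_bogoliubov_vacuum, smul_eq_mul,
    Ring.inverse_mul_cancel _ (isUnit_closedPart q f A)]

theorem isBogoliubov_normalizedSelfGluing (A : Coeffs (M + 2) (GlueRing R)) :
    IsBogoliubov (normalizedSelfGluing q f (bogoliubov A) A) := by
  let : TopologicalSpace R[T;T⁻¹] := ⊥
  have : DiscreteTopology R[T;T⁻¹] := ⟨rfl⟩
  set u := Ring.inverse (closedPart q f A)
  let L : Fock (M + 2) (GlueRing R) →ₗ[GlueRing R] Fock M (GlueRing R) := u • selfGluingₗ q f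
  have hopen (i : Fin M) (r : ℤ) :
      L (psiStar (Fin.castAdd 2 i) r (bogoliubov A)) = psiStar i r (L (bogoliubov A)) :=
    (congrArg (u • ·) (selfGluing_psiStar_castAdd q f i r _)).trans
      ((psiStar i r).map_smul u _).symm
  have hglued (c : Fin 2) (n : ℕ) : ∃ i, ∃ m : ℕ, ∃ a : GlueRing R, PowerSeries.X ∣ a ∧
      L (psiStar (Fin.natAdd M c) (-(n : ℤ) - 1) (bogoliubov A))
        = a • L (psiStar i (m : ℤ) (bogoliubov A)) := by
    refine ⟨Fin.natAdd M c.rev, n, -glueCoeffs q f c.rev c n n, ?_, ?_⟩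
    · simpa using X_pow_dvd_glueCoeffs q f (i := c.rev) (j := c) (.inl n.zero_le)
    · exact (congrArg (u • ·) (selfGluing_psiStar_natAdd q f c n _)).trans (smul_comm _ _ _)
  have hvacuum : L (bogoliubov A) (fun _ => Maya.vacuum) = 1 :=
    normalizedSelfGluing_bogoliubov_vacuum q f A
  have hneutral : IsNeutral (L (bogoliubov A)) := fun T hT =>
    isNeutral_selfGluing q f (isNeutral_bogoliubov A) T (right_ne_zero_of_mul hT)
  obtain ⟨A', hA'⟩ := (particleRelations_bogoliubov A).exists_map isClosed_X_pow_dvd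
    (fun _ => eq_zero_of_forall_X_pow_dvd) ((continuous_selfGluingₗ q f).const_smul u)
    hopen hglued hvacuum
  have hsmul := hA'.eq_smul_bogoliubov hneutral
  rw [hvacuum, one_smul] at hsmul
  exact ⟨A', hsmul⟩

end SelfGluing

end FermionGluing

end

open FermionGluing in
theorem mainTheorem6 {R : Type*} [CommRing R] [Algebra ℂ R] (q : Rˣ) (f : ℤ) (M N : ℕ) :
    (∀ (V : Fock (M + 2) (GlueRing R)) (A : Coeffs (M + 2) (GlueRing R)), V = bogoliubov A →
      (∀ T : States M, PairingConverges (slice V T) (glueVector q f)) ∧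
      PairingConverges (bogoliubov (restrictAB A)) (glueVector q f) ∧
      IsUnit (closedPart q f A) ∧
      IsBogoliubov (normalizedSelfGluing q f V A)) ∧
    (∀ (V₁ : Fock (M + 1) (GlueRing R)) (A₁ : Coeffs (M + 1) (GlueRing R))
      (V₂ : Fock (N + 1) (GlueRing R)) (A₂ : Coeffs (N + 1) (GlueRing R)),
      V₁ = bogoliubov A₁ → V₂ = bogoliubov A₂ →
      tensor V₁ V₂ = bogoliubov (blockCoeffs A₁ A₂) ∧
      (∀ T : States (M + N), PairingConverges (slice (tensor V₁ V₂) T) (glueVector q f)) ∧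
      PairingConverges (bogoliubov (restrictAB (blockCoeffs A₁ A₂))) (glueVector q f) ∧
      IsUnit (closedPart q f (blockCoeffs A₁ A₂)) ∧
      IsBogoliubov (normalizedSelfGluing q f (tensor V₁ V₂) (blockCoeffs A₁ A₂))) := by
  have hconverges := (adicallyNull_glueVector q f).pairingConverges
  refine ⟨?_, ?_⟩
  · rintro V A rfl
    exact ⟨fun T => hconverges _, hconverges _, isUnit_closedPart q f A,
      isBogoliubov_normalizedSelfGluing q f A⟩
  · rintro V₁ A₁ V₂ A₂ rfl rfl
    have htensor := tensor_bogoliubov A₁ A₂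
    refine ⟨htensor, fun T => hconverges _, hconverges _, isUnit_closedPart q f _, ?_⟩
    rw [htensor]
    exact isBogoliubov_normalizedSelfGluing q f (blockCoeffs A₁ A₂)
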